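/- Let $G$ be a finite abelian $2$-group, and put $l=|G|$. All local rings below are commutative, and $\mathcal C$ denotes the category of Artinian local $\mathbf Z_2$-algebras with residue field $\mathbf F_2$. For a commutative ring $A$, an $A$-valued determinant of degree $2$ on $G$ is a polynomial law $\mathbf D\colon A[G]\to A$ (a natural family of maps $\mathbf D_S\colon S[G]\to S$, for all commutative $A$-algebras $S$) which is multiplicative ($\mathbf D(1)=1$, $\mathbf D(xy)=\mathbf D(x)\mathbf D(y)$) and homogeneous of degree $2$ ($\mathbf D(bx)=b^2\mathbf D(x)$ for $b\in S$). A representation $\rho\colon G\to \mathrm{GL}_2(A)$, extended linearly to group algebras, gives the determinant $\mathbf D_\rho=\det\circ\rho$. Let $R^{\mathrm{ps}}$, with universal determinant $\mathbf D^{\mathrm{univ}}$, be the universal pseudodeformation ring of the trivial residual representation: the complete Noetherian local $\mathbf Z_2$-algebra with residue field $\mathbf F_2$ that prorepresents the functor sending $A\in\mathcal C$ to the set of $A$-valued determinants of degree $2$ on $G$ whose base change to $\mathbf F_2$ is the determinant of the trivial representation $G\to\mathrm{GL}_2(\mathbf F_2)$. Let $R^{\square}$, with universal lifting $\rho^{\mathrm{univ}}\colon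 G\to\mathrm{GL}_2(R^{\square})$, be the complete Noetherian local $\mathbf Z_2$-algebra with residue field $\mathbf F_2$ that prorepresents the functor sending $A\in\mathcal C$ to the set of homomorphisms $G\to\mathrm{GL}_2(A)$ with trivial reduction modulo $\mathfrak m_A$. Let $R^{\mathrm{coeff}}\subset R^{\square}$ be the $\mathbf Z_2$-subalgebra generated by the coefficients of the characteristic polynomials of $\rho^{\mathrm{univ}}(g)$, $g\in G$. Theorem. The rings $R^{\mathrm{ps}}$ and $R^{\square}$ exist. There is an isomorphism of $\mathbf Z_2$-algebras $R^{\mathrm{ps}}\cong R^{\mathrm{coeff}}$ such that the composite $R^{\mathrm{ps}}\cong R^{\mathrm{coeff}}\subset R^{\square}$ carries $\mathbf D^{\mathrm{univ}}$ to $\mathbf D_{\rho^{\mathrm{univ}}}$, and both $R^{\mathrm{ps}}$ and $R^{\mathrm{coeff}}$ are isomorphic, as $\mathbf Z_2$-modules, to $\mathbf Z_2^{\,r}$ with $r=l(l+1)/2>0$. -/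

import Mathlib

open scoped TensorProduct
open IsLocalRing

universe u w

namespace PseudoDef

noncomputable section

/-- An `A`-valued determinant of degree `d` on the group `G`: a polynomial law `A[G] → A` that is
multiplicative and homogeneous of degree `d`. (Groups and coefficient rings are discrete, so that
continuity holds automatically.) -/
structure Determinant (A : Type u) [CommRing A] (G : Type w) [Group G] (d : ℕ) where
  /-- The underlying polynomial law: natural maps `S ⊗ A[G] → S ⊗ A`, for all commutative
  `A`-algebras `S`. -/
  law : MonoidAlgebra A G →ₚₗ[A] A
  map_one : ∀ (S : Type u) [CommRing S] [Algebra A S],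
    law.toFun' S (1 : S ⊗[A] MonoidAlgebra A G) = 1
  map_mul : ∀ (S : Type u) [CommRing S] [Algebra A S] (x y : S ⊗[A] MonoidAlgebra A G),
    law.toFun' S (x * y) = law.toFun' S x * law.toFun' S y
  map_smul : ∀ (S : Type u) [CommRing S] [Algebra A S] (b : S) (x : S ⊗[A] MonoidAlgebra A G),
    law.toFun' S (b • x) = b ^ d • law.toFun' S x

section Determinants

variable {A B S : Type u} [CommRing A] [CommRing B] [CommRing S]
variable {G : Type w} [Group G] {d : ℕ}

/-- The canonical identification `S[G] = S ⊗ A[G]`, `s g ↦ s ⊗ g`, for an `A`-algebra `S`. -/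
def toTensor (A S : Type u) [CommRing A] [CommRing S] [Algebra A S] (G : Type w) [Group G] :
    MonoidAlgebra S G →ₐ[S] S ⊗[A] MonoidAlgebra A G :=
  MonoidAlgebra.lift S (S ⊗[A] MonoidAlgebra A G) G
    ((Algebra.TensorProduct.includeRight (R := A) (A := S)
      (B := MonoidAlgebra A G)).toMonoidHom.comp (MonoidAlgebra.of A G))

theorem toTensor_single (A S : Type u) [CommRing A] [CommRing S] [Algebra A S] (G : Type w)
    [Group G] (g : G) (s : S) :
    toTensor A S G (MonoidAlgebra.single g s) = s ⊗ₜ[A] MonoidAlgebra.single g 1 := by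
  simp [toTensor, TensorProduct.smul_tmul']

theorem toTensor_bijective (A S : Type u) [CommRing A] [CommRing S] [Algebra A S] (G : Type w)
    [Group G] : Function.Bijective (toTensor A S G) := by
  let ψ : S ⊗[A] MonoidAlgebra A G →ₐ[S] MonoidAlgebra S G :=
    Algebra.TensorProduct.lift (Algebra.ofId S (MonoidAlgebra S G))
      (MonoidAlgebra.lift A (MonoidAlgebra S G) G (MonoidAlgebra.of S G))
      (fun _ _ => Algebra.commute_algebraMap_left _ _)
  have hψ : ∀ g : G, ψ (1 ⊗ₜ[A] MonoidAlgebra.single g 1) = MonoidAlgebra.single g 1 := by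
    intro g
    refine (Algebra.TensorProduct.lift_tmul _ _ _ _ _).trans ?_
    rw [_root_.map_one, one_mul, MonoidAlgebra.lift_single, one_smul, MonoidAlgebra.of_apply]
  have h1 : ψ.comp (toTensor A S G) = AlgHom.id S _ := by
    apply MonoidAlgebra.algHom_ext
    · intro g
      change ψ (toTensor A S G (MonoidAlgebra.single g 1)) = MonoidAlgebra.single g 1
      rw [toTensor_single, hψ]
    · exact Subsingleton.elim _ _
  have h2 : (toTensor A S G).comp ψ = AlgHom.id S _ := by
    apply Algebra.TensorProduct.ext'
    intro s x
    induction x using MonoidAlgebra.induction_linear with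
    | zero => simp
    | add x y hx hy => rw [TensorProduct.tmul_add, _root_.map_add, hx, hy, _root_.map_add]
    | single g a =>
      have h3 : s ⊗ₜ[A] MonoidAlgebra.single g a
          = (a • s) • ((1 : S) ⊗ₜ[A] MonoidAlgebra.single g (1 : A)) := by
        rw [TensorProduct.smul_tmul', smul_eq_mul, mul_one, TensorProduct.smul_tmul]
        simp
      rw [h3, _root_.map_smul, _root_.map_smul, AlgHom.comp_apply, hψ, toTensor_single]
      rfl
  exact Function.bijective_iff_has_inverse.mpr
    ⟨ψ, fun x => DFunLike.congr_fun h1 x, fun x => DFunLike.congr_fun h2 x⟩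

/-- The component `D_S : S[G] → S` of a determinant at the `A`-algebra `S` with structure map `φ`,
through the canonical identifications `S[G] = S ⊗ A[G]` and `S ⊗ A = S`. -/
def Determinant.eval (D : Determinant A G d) (φ : A →+* S) (x : MonoidAlgebra S G) : S :=
  letI : Algebra A S := φ.toAlgebra
  Algebra.TensorProduct.rid A S S (D.law.toFun' S (toTensor A S G x))

/-- `E` is the base change `D ⊗_A B` of the determinant `D` along `f : A → B`: at every
`B`-algebra `S`, it has the same component `S[G] → S` as `D` has at the `A`-algebra `S`. -/
def Determinant.IsBaseChange (f : A →+* B) (D : Determinant A G d) (E : Determinant B G d) :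
    Prop :=
  ∀ (S : Type u) [CommRing S] (φ : B →+* S) (x : MonoidAlgebra S G),
    E.eval φ x = D.eval (φ.comp f) x

/-- The `S`-linear extension `S[G] → M_d(S)` of a representation `ρ : G → GL_d(B)`, for a
`B`-algebra `S` with structure map `φ`. -/
def linExt (φ : B →+* S) (ρ : G →* GL (Fin d) B) :
    MonoidAlgebra S G →ₐ[S] Matrix (Fin d) (Fin d) S :=
  MonoidAlgebra.lift S (Matrix (Fin d) (Fin d) S) G
    ((Units.coeHom (Matrix (Fin d) (Fin d) S)).comp ((Matrix.GeneralLinearGroup.map φ).comp ρ))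

/-- The base change of `D` along `f : A → B` is the determinant `D_ρ = det ∘ ρ` attached to the
representation `ρ : G → GL_d(B)`. -/
def Determinant.BaseChangesToRep (f : A →+* B) (D : Determinant A G d) (ρ : G →* GL (Fin d) B) :
    Prop :=
  ∀ (S : Type u) [CommRing S] (φ : B →+* S) (x : MonoidAlgebra S G),
    D.eval (φ.comp f) x = (linExt φ ρ x).det

end Determinants

/-- `A` has residue field `𝔽_p`. (Such an identification is unique, and every `ℤ_p`-algebra
homomorphism between two local rings with residue field `𝔽_p` is local and compatible with it.) -/
def HasResidueField (p : ℕ) (A : Type u) [CommRing A] [IsLocalRing A] : Prop :=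
  Nonempty (ResidueField A ≃+* ZMod p)

/-- `A` is an object of the category of Artinian local `ℤ_p`-algebras with residue
field `𝔽_p`. -/
structure IsCoeffRing (p : ℕ) (A : Type u) [CommRing A] [IsLocalRing A] : Prop where
  artinian : IsArtinianRing A
  residue : HasResidueField p A

/-- `R` is a complete Noetherian local ring with residue field `𝔽_p`. -/
structure IsProCoeffRing (p : ℕ) (R : Type u) [CommRing R] [IsLocalRing R] : Prop where
  noetherian : IsNoetherianRing R
  complete : IsAdicComplete (maximalIdeal R) R
  residue : HasResidueField p R

section Deformations

variable {G : Type w} [Group G] {d : ℕ}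

/-- `D` reduces, modulo the maximal ideal, to the determinant of the trivial representation
`G → GL_d(𝔽_p)`. -/
def Determinant.IsResiduallyTrivial {A : Type u} [CommRing A] [IsLocalRing A]
    (D : Determinant A G d) : Prop :=
  D.BaseChangesToRep (residue A) (1 : G →* GL (Fin d) (ResidueField A))

/-- `ρ` is a lifting of the trivial representation `G → GL_d(𝔽_p)`. -/
def IsLifting {A : Type u} [CommRing A] [IsLocalRing A] (ρ : G →* GL (Fin d) A) : Prop :=
  (Matrix.GeneralLinearGroup.map (residue A)).comp ρ = 1

/-- `(R, D)` is the universal pseudodeformation ring of the trivial `d`-dimensional residual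
pseudorepresentation of `G` over `𝔽_p`, with its universal determinant: `R` is a complete
Noetherian local `ℤ_p`-algebra which, through `D`, prorepresents the functor that sends `A` to the
set of residually trivial `A`-valued determinants of degree `d` on `G`. (A `ℤ_p`-algebra
homomorphism from `R` to an object `A` is automatically local, hence continuous.) -/
structure IsUniversalPseudodeformation (p : ℕ) [Fact p.Prime] {R : Type u} [CommRing R]
    [IsLocalRing R] [Algebra ℤ_[p] R] (D : Determinant R G d) : Prop where
  isProCoeffRing : IsProCoeffRing p R
  residuallyTrivial : D.IsResiduallyTrivial
  existsUnique : ∀ (A : Type u) [CommRing A] [IsLocalRing A] [Algebra ℤ_[p] A],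
    IsCoeffRing p A → ∀ E : Determinant A G d, E.IsResiduallyTrivial →
      ∃! f : R →ₐ[ℤ_[p]] A, D.IsBaseChange (f : R →+* A) E

/-- `(R, ρ)` is the universal (framed) lifting ring of the trivial `d`-dimensional residual
representation of `G` over `𝔽_p`, with its universal lifting: `R` is a complete Noetherian local
`ℤ_p`-algebra which, through `ρ`, prorepresents the functor that sends `A` to the set of liftings
`G → GL_d(A)` of the trivial representation. -/
structure IsUniversalLifting (p : ℕ) [Fact p.Prime] {R : Type u} [CommRing R]
    [IsLocalRing R] [Algebra ℤ_[p] R] (ρ : G →* GL (Fin d) R) : Prop where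
  isProCoeffRing : IsProCoeffRing p R
  isLifting : IsLifting ρ
  existsUnique : ∀ (A : Type u) [CommRing A] [IsLocalRing A] [Algebra ℤ_[p] A],
    IsCoeffRing p A → ∀ σ : G →* GL (Fin d) A, IsLifting σ →
      ∃! f : R →ₐ[ℤ_[p]] A, (Matrix.GeneralLinearGroup.map (f : R →+* A)).comp ρ = σ

/-- The coefficient subring: the `ℤ_p`-subalgebra of `R` generated by the coefficients of the
characteristic polynomials of all `ρ g`. -/
def coeffSubring (p : ℕ) [Fact p.Prime] {R : Type u} [CommRing R] [Algebra ℤ_[p] R]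
    (ρ : G →* GL (Fin d) R) : Subalgebra ℤ_[p] R :=
  Algebra.adjoin ℤ_[p]
    {c : R | ∃ (g : G) (i : ℕ), c = (ρ g : Matrix (Fin d) (Fin d) R).charpoly.coeff i}

end Deformations

end

end PseudoDef

/-! Everything rests on one ring, the symmetric tensors `symTensors k G` inside `k[G] ⊗ k[G] = k[G ×
G]`. Evaluating a determinant of degree 2 at a generic element shows that its components are
quadratic forms with coefficients independent of the algebra. As `k[G]` is free, `x ↦ x ⊗ x` is the
universal quadratic map on it, and because squares span, a quadratic map that is multiplicative and
sends 1 to 1 corresponds to an algebra homomorphism (`exists_algHom_symSquare`). So determinants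
over `A` are homomorphisms from the symmetric tensors to `A`, compatibly with base change
(`IsClassifiedBy.isBaseChange_iff`).

For `k = ℤ₂` and `G` a finite abelian 2-group, `ℤ₂[G × G]` is local, hence so is its subring of
symmetric tensors. That ring is finite over `ℤ₂`, therefore complete, and has only one homomorphism
to `𝔽₂`, so residual triviality is automatic: it is the universal pseudodeformation ring. Orbit sums
indexed by `Sym2 G` form a basis, which gives the rank.

The determinant of the universal lifting is classified by a map `θ` to the lifting ring. It is
injective: the sum of the two tautological characters of `G` over `ℤ₂[G × G]` is classified by the
inclusion of the symmetric tensors, and modulo each power of the maximal ideal it is a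
specialization of the universal lifting. Its image is the coefficient ring, since basis elements go
to `det ρ(g)` and `tr ρ(gh⁻¹) det ρ(h)`. -/

namespace PseudoDef

noncomputable section

/-! ### Local rings with residue field `𝔽₂`, completeness, and Artinian test rings. -/

section CommutativeAlgebra

theorem zmod_two_eq_one_of_ne_zero {x : ZMod 2} (hx : x ≠ 0) : x = 1 := by
  revert x; decide

/-- A map to `𝔽₂` is onto, so its kernel is the maximal ideal. Composing with such a map shows that
homomorphisms between these local rings are local. -/
theorem mem_maximalIdeal_iff_of_ringHom_zmod_two {R : Type*} [CommRing R] [IsLocalRing R]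
    (h : R →+* ZMod 2) (x : R) : x ∈ maximalIdeal R ↔ h x = 0 := by
  have : (RingHom.ker h).IsMaximal :=
    RingHom.ker_isMaximal_of_surjective h (ZMod.ringHom_surjective h)
  rw [← IsLocalRing.eq_maximalIdeal this, RingHom.mem_ker]

/-- A local ring has at most one ring homomorphism to `𝔽₂`. -/
theorem ringHom_zmod_two_ext {R : Type*} [CommRing R] [IsLocalRing R] (f g : R →+* ZMod 2) :
    f = g := by
  have key := mem_maximalIdeal_iff_of_ringHom_zmod_two (R := R)
  ext x
  by_cases hx : x ∈ maximalIdeal R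
  · rw [(key f x).1 hx, (key g x).1 hx]
  · rw [zmod_two_eq_one_of_ne_zero (mt (key f x).2 hx),
      zmod_two_eq_one_of_ne_zero (mt (key g x).2 hx)]

theorem hasResidueField_of_ringHom {R : Type u} [CommRing R] [IsLocalRing R]
    (h : R →+* ZMod 2) : HasResidueField 2 R := by
  have hs := ZMod.ringHom_surjective h
  have : RingHom.ker h = maximalIdeal R :=
    IsLocalRing.eq_maximalIdeal (RingHom.ker_isMaximal_of_surjective h hs)
  exact ⟨(Ideal.quotEquivOfEq this.symm).trans (RingHom.quotientKerEquivOfSurjective hs)⟩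

theorem HasResidueField.nonempty_ringHom {R : Type u} [CommRing R] [IsLocalRing R]
    (h : HasResidueField 2 R) : Nonempty (R →+* ZMod 2) := by
  obtain ⟨e⟩ := h
  exact ⟨(e : ResidueField R →+* ZMod 2).comp (residue R)⟩

theorem maximalIdeal_pow_succ_ne_top {R : Type*} [CommRing R] [IsLocalRing R] (n : ℕ) :
    maximalIdeal R ^ (n + 1) ≠ ⊤ := fun h =>
  Ideal.IsMaximal.ne_top (maximalIdeal.isMaximal R)
    (top_le_iff.1 (h ▸ Ideal.pow_le_self n.succ_ne_zero))

instance isLocalRing_quotient_pow_succ {R : Type*} [CommRing R] [IsLocalRing R] (n : ℕ) :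
    IsLocalRing (R ⧸ maximalIdeal R ^ (n + 1)) :=
  have : Nontrivial (R ⧸ maximalIdeal R ^ (n + 1)) :=
    Ideal.Quotient.nontrivial_iff.2 (maximalIdeal_pow_succ_ne_top n)
  IsLocalRing.of_surjective' (Ideal.Quotient.mk _) Ideal.Quotient.mk_surjective

/-- These quotients are the test objects through which universal properties on Artinian rings reach
complete rings. The exponent is positive so that the quotient is nonzero. -/
theorem isCoeffRing_quotient_pow_succ {R : Type u} [CommRing R] [IsLocalRing R]
    [IsNoetherianRing R] (h : HasResidueField 2 R) (n : ℕ) :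
    IsCoeffRing 2 (R ⧸ maximalIdeal R ^ (n + 1)) where
  artinian := by
    rw [isArtinianRing_iff_isNilpotent_maximalIdeal]
    refine ⟨n + 1, ?_⟩
    have := IsLocalHom.of_surjective (Ideal.Quotient.mk (maximalIdeal R ^ (n + 1)))
      Ideal.Quotient.mk_surjective
    have : maximalIdeal (R ⧸ maximalIdeal R ^ (n + 1)) ≤
        (maximalIdeal R).map (Ideal.Quotient.mk (maximalIdeal R ^ (n + 1))) := by
      intro x hx
      obtain ⟨x, rfl⟩ := Ideal.Quotient.mk_surjective x
      refine Ideal.mem_map_of_mem _ ?_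
      rw [mem_maximalIdeal, mem_nonunits_iff] at hx ⊢
      exact fun hu => hx (hu.map _)
    refine le_bot_iff.1 ((Ideal.pow_right_mono this _).trans ?_)
    rw [← Ideal.map_pow, Ideal.map_quotient_self]
  residue := by
    obtain ⟨f⟩ := h.nonempty_ringHom
    refine hasResidueField_of_ringHom (Ideal.Quotient.lift (maximalIdeal R ^ (n + 1)) f ?_)
    intro a ha
    rw [← mem_maximalIdeal_iff_of_ringHom_zmod_two]
    exact Ideal.pow_le_self n.succ_ne_zero ha

theorem isPrecomplete_of_surjective {R M N : Type*} [CommRing R] [AddCommGroup M] [Module R M]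
    [AddCommGroup N] [Module R N] (I : Ideal R) [IsPrecomplete I M] (f : M →ₗ[R] N)
    (hf : Function.Surjective f) : IsPrecomplete I N := by
  rw [← AdicCompletion.of_surjective_iff]
  intro y
  obtain ⟨x, rfl⟩ := AdicCompletion.map_surjective I hf y
  obtain ⟨x, rfl⟩ := AdicCompletion.of_surjective I M x
  exact ⟨f x, (AdicCompletion.map_of I f x).symm⟩

/-- For finite `M` the map from `R̂ ⊗ M` to the completion of `M` is onto, and each element of `R̂`
comes from some `r` in `R`, so a pure tensor with `m` is the image of `r • m`. -/
theorem isPrecomplete_of_finite {R M : Type*} [CommRing R] [AddCommGroup M] [Module R M]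
    [Module.Finite R M] (I : Ideal R) [IsPrecomplete I R] : IsPrecomplete I M := by
  rw [← AdicCompletion.of_surjective_iff]
  intro y
  obtain ⟨t, rfl⟩ := AdicCompletion.ofTensorProduct_surjective_of_finite I M y
  change _ ∈ LinearMap.range (AdicCompletion.of I M)
  induction t with
  | zero => simp
  | add x y hx hy => rw [map_add]; exact add_mem hx hy
  | tmul r m =>
    obtain ⟨r, rfl⟩ := AdicCompletion.of_surjective I R r
    refine ⟨r • m, ?_⟩
    rw [AdicCompletion.ofTensorProduct_tmul, map_smul]
    ext n
    simp
    rfl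

/-- Completeness for an ideal `I` implies completeness for every ideal between `I` and its
radical. -/
theorem isPrecomplete_of_pow_le {R : Type*} [CommRing R] {I J : Ideal R} [IsPrecomplete I R]
    {k : ℕ} (hJI : J ^ k ≤ I) (hIJ : I ≤ J) : IsPrecomplete J R := by
  refine ⟨fun f hf => ?_⟩
  -- The subsequence of indices `(k + 1) * m` is Cauchy for `I`. Using `k + 1` instead of `k`
  -- ensures `n ≤ (k + 1) * n` even for `k = 0`.
  have hk : J ^ (k + 1) ≤ I := (Ideal.pow_le_pow_right k.le_succ).trans hJI
  obtain ⟨L, hL⟩ := IsPrecomplete.prec (I := I) (M := R) inferInstance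
    (f := fun m => f ((k + 1) * m)) (by
      intro m n hmn
      have := hf (Nat.mul_le_mul_left (k + 1) hmn)
      rw [SModEq.sub_mem, smul_eq_mul, Ideal.mul_top] at this ⊢
      rw [pow_mul] at this
      exact Ideal.pow_right_mono hk m this)
  refine ⟨L, fun n => ?_⟩
  have h1 := hf (show n ≤ (k + 1) * n by nlinarith)
  have h2 := hL n
  rw [SModEq.sub_mem, smul_eq_mul, Ideal.mul_top] at h1 h2 ⊢
  simpa using add_mem h1 (Ideal.pow_right_mono hIJ n h2)

/-- Existence of limits descends along surjections; separatedness does not, and comes from `R` being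
Noetherian local. -/
theorem isAdicComplete_of_surjective {T R : Type*} [CommRing T] [CommRing R] [IsLocalRing R]
    [IsNoetherianRing R] (I : Ideal T) [IsPrecomplete I T] (f : T →+* R)
    (hf : Function.Surjective f) (hI : I.map f = maximalIdeal R) :
    IsAdicComplete (maximalIdeal R) R := by
  let := f.toAlgebra
  have : IsPrecomplete I R := isPrecomplete_of_surjective I (Algebra.linearMap T R) hf
  have : IsPrecomplete (I.map (algebraMap T R)) R := IsPrecomplete.map_algebraMap_iff.2 this
  rw [RingHom.algebraMap_toAlgebra, hI] at this
  exact { (inferInstance : IsHausdorff (maximalIdeal R) R), this with }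

/-- A homomorphism of complete Noetherian local rings that induces bijections on the
homomorphisms to Artinian test rings is an isomorphism. -/
theorem bijective_of_existsUnique {U R : Type u} [CommRing U] [IsLocalRing U]
    [CommRing R] [IsLocalRing R] [Algebra ℤ_[2] U] [Algebra ℤ_[2] R]
    (hU : IsProCoeffRing 2 U) (hR : IsProCoeffRing 2 R) (g : U →ₐ[ℤ_[2]] R)
    (H : ∀ (A : Type u) [CommRing A] [IsLocalRing A] [Algebra ℤ_[2] A], IsCoeffRing 2 A →
      ∀ θ : U →ₐ[ℤ_[2]] A, ∃! f : R →ₐ[ℤ_[2]] A, f.comp g = θ) :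
    Function.Bijective g := by
  have := hU.noetherian
  have := hR.noetherian
  have := hU.complete
  -- Extending the projections of `U` along `g` gives approximate left inverses of `g`; uniqueness
  -- makes them compatible, and their limit is `h`.
  have hex : ∀ n, ∃ f : R →ₐ[ℤ_[2]] U ⧸ maximalIdeal U ^ (n + 1),
      f.comp g = Ideal.Quotient.mkₐ ℤ_[2] _ := fun n =>
    (H _ (isCoeffRing_quotient_pow_succ hU.residue n) _).exists
  choose f hf using hex
  have hcompat : ∀ {m n : ℕ} (h : m + 1 ≤ n + 1),
      (Ideal.Quotient.factorₐ ℤ_[2] (Ideal.pow_le_pow_right h)).comp (f n) = f m := by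
    intro m n h
    refine (H _ (isCoeffRing_quotient_pow_succ hU.residue m)
      (Ideal.Quotient.mkₐ ℤ_[2] _)).unique ?_ (hf m)
    rw [AlgHom.comp_assoc, hf, Ideal.Quotient.factorₐ_comp_mk]
  -- The passage to the limit needs a map for every exponent, including 0, where the quotient is no
  -- test ring; hence the shift.
  let F : ∀ n : ℕ, R →ₐ[ℤ_[2]] U ⧸ maximalIdeal U ^ n := fun n =>
    (Ideal.Quotient.factorₐ ℤ_[2] (Ideal.pow_le_pow_right n.le_succ)).comp (f n)
  have hF : ∀ {m n : ℕ} (hle : m ≤ n),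
      (Ideal.Quotient.factorₐ ℤ_[2] (Ideal.pow_le_pow_right hle)).comp (F n) = F m := by
    intro m n hle
    ext x
    obtain ⟨y, hy⟩ := Ideal.Quotient.mk_surjective (f n x)
    have := DFunLike.congr_fun (hcompat (Nat.succ_le_succ hle)) x
    simp only [F, AlgHom.comp_apply] at this ⊢
    rw [← this, ← hy]
    rfl
  let h : R →ₐ[ℤ_[2]] U := IsAdicComplete.liftAlgHom (maximalIdeal U) F hF
  have hmk : ∀ n x, (Ideal.Quotient.mk (maximalIdeal U ^ n)) (h x) = F n x := fun n x =>
    IsAdicComplete.mk_liftAlgHom (maximalIdeal U) F hF n x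
  have hhg : h.comp g = AlgHom.id _ _ := by
    refine IsAdicComplete.algHom_ext (maximalIdeal U) fun n => ?_
    ext u
    change Ideal.Quotient.mk _ (h (g u)) = Ideal.Quotient.mk _ u
    rw [hmk]
    have := DFunLike.congr_fun (hf n) u
    simp only [F, AlgHom.comp_apply] at this ⊢
    rw [this]
    rfl
  have hgh : ∀ x, g (h x) = x := by
    intro x
    have := hR.complete
    rw [IsHausdorff.eq_iff_smodEq (I := maximalIdeal R)]
    intro n
    refine SModEq.mono (Submodule.pow_smul_top_le _ R n.le_succ) ?_
    -- Since `h ∘ g = id`, the maps `g ∘ h` and `id` agree after precomposition with `g`, so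
    -- uniqueness identifies them modulo every power.
    have key : (Ideal.Quotient.mkₐ ℤ_[2] (maximalIdeal R ^ (n + 1))).comp (g.comp h) =
        Ideal.Quotient.mkₐ ℤ_[2] _ := by
      refine (H _ (isCoeffRing_quotient_pow_succ hR.residue n)
        ((Ideal.Quotient.mkₐ ℤ_[2] _).comp g)).unique ?_ rfl
      rw [AlgHom.comp_assoc, AlgHom.comp_assoc, hhg, AlgHom.comp_id]
    have := DFunLike.congr_fun key x
    change Ideal.Quotient.mk _ (g (h x)) = Ideal.Quotient.mk _ x at this
    rw [Ideal.Quotient.eq] at this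
    rw [SModEq.sub_mem, smul_eq_mul, Ideal.mul_top]
    exact this
  exact Function.bijective_iff_has_inverse.2 ⟨h, fun u => DFunLike.congr_fun hhg u, hgh⟩

open scoped Pointwise in
/-- Homomorphisms from a local ring with residue field `𝔽₂` to Artinian local rings are
determined by their values on generators of the maximal ideal. -/
theorem algHom_ext_of_span_eq_maximalIdeal {R A : Type u} [CommRing R] [IsLocalRing R]
    [Algebra ℤ_[2] R] [CommRing A] [IsLocalRing A] [Algebra ℤ_[2] A]
    (hR : HasResidueField 2 R) (hA : IsCoeffRing 2 A) {s : Set R}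
    (hs : Ideal.span s = maximalIdeal R) {f g : R →ₐ[ℤ_[2]] A} (hfg : ∀ x ∈ s, f x = g x) :
    f = g := by
  obtain ⟨πR⟩ := hR.nonempty_ringHom
  obtain ⟨πA⟩ := hA.residue.nonempty_ringHom
  have hmap : ∀ f : R →ₐ[ℤ_[2]] A, (maximalIdeal R).map f ≤ maximalIdeal A := by
    intro f
    refine Ideal.map_le_iff_le_comap.2 fun x hx => ?_
    change f x ∈ maximalIdeal A
    rw [mem_maximalIdeal_iff_of_ringHom_zmod_two πA]
    exact (mem_maximalIdeal_iff_of_ringHom_zmod_two (πA.comp (f : R →+* A)) x).1 hx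
  have := hA.artinian
  obtain ⟨N, hN⟩ := (isArtinianRing_iff_isNilpotent_maximalIdeal A).1 hA.artinian
  have hzero : ∀ f : R →ₐ[ℤ_[2]] A, ∀ x ∈ maximalIdeal R ^ N, f x = 0 := by
    intro f x hx
    have h1 : f x ∈ (maximalIdeal R ^ N).map f := Ideal.mem_map_of_mem f hx
    rw [Ideal.map_pow] at h1
    have h2 := Ideal.pow_right_mono (hmap f) N h1
    rwa [hN] at h2
  -- Descending induction on `k`: both maps kill the `N`-th power, and agreement on one power of the
  -- maximal ideal is pushed to the previous one.
  have hstep : ∀ k, (∀ x ∈ maximalIdeal R ^ (k + 1), f x = g x) →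
      ∀ x ∈ maximalIdeal R ^ k, f x = g x := by
    intro k hk x hx
    have hgen : ∀ p ∈ s ^ k, f p = g p := by
      clear hx hk
      induction k with
      | zero => simp
      | succ k ih =>
        rintro _ ⟨a, ha, b, hb, rfl⟩
        simp only [map_mul, ih a ha, hfg b hb]
    have hpow : maximalIdeal R ^ k = Submodule.span R (s ^ k) := by
      rw [← hs, Ideal.span, Submodule.span_pow]
    rw [hpow] at hx
    induction hx using Submodule.span_induction with
    | mem x h => exact hgen x h
    | zero => simp
    | add x y _ _ hx hy => rw [map_add, map_add, hx, hy]
    | smul r x h hx =>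
      -- As the residue field is `𝔽₂`, `r` is 0 or 1 up to the maximal ideal. The scalar part is
      -- handled by linearity and the rest falls into the next power.
      obtain ⟨c, hc⟩ : ∃ c : ℤ_[2], r - algebraMap ℤ_[2] R c ∈ maximalIdeal R := by
        refine ⟨if πR r = 0 then 0 else 1, ?_⟩
        rw [mem_maximalIdeal_iff_of_ringHom_zmod_two πR]
        split_ifs with h0
        · simpa using h0
        · simp [zmod_two_eq_one_of_ne_zero h0]
      have h1 : (r - algebraMap ℤ_[2] R c) * x ∈ maximalIdeal R ^ (k + 1) := by
        rw [pow_succ', hpow]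
        exact Ideal.mul_mem_mul hc h
      have h2 : r • x = (r - algebraMap ℤ_[2] R c) * x + algebraMap ℤ_[2] R c * x := by
        rw [smul_eq_mul]; ring
      rw [h2, map_add, map_add, hk _ h1, map_mul f (algebraMap _ _ c), map_mul g (algebraMap _ _ c),
        hx, f.commutes, g.commutes]
  have hall : ∀ j ≤ N, ∀ x ∈ maximalIdeal R ^ (N - j), f x = g x := by
    intro j
    induction j with
    | zero =>
      exact fun _ x hx => by
        rw [hzero f x (by simpa using hx), hzero g x (by simpa using hx)]
    | succ j ih =>
      intro hj
      refine hstep _ ?_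
      rw [show N - (j + 1) + 1 = N - j by omega]
      exact ih (by omega)
  ext x
  exact hall N le_rfl x (by simp)

end CommutativeAlgebra

/-! ### Quadratic maps on group algebras. -/

section QuadraticMaps

variable {S : Type*} [CommRing S] {G : Type*}

/-- The coefficient of `g`, as a linear functional on `S[G]`. -/
def coeffFunctional (S : Type*) [CommRing S] {G : Type*} (g : G) : MonoidAlgebra S G →ₗ[S] S where
  toFun x := x.coeff g
  map_add' := by simp
  map_smul' := by simp

@[simp]
theorem coeffFunctional_apply (S : Type*) [CommRing S] {G : Type*} (g : G)
    (x : MonoidAlgebra S G) : coeffFunctional S g x = x.coeff g := rfl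

/-- The quadratic form `∑ c g h x_g x_h` on `S[G]`. -/
def quadForm [Fintype G] (c : G → G → S) : QuadraticMap S (MonoidAlgebra S G) S :=
  ∑ g, ∑ h, c g h • QuadraticMap.linMulLin (coeffFunctional S g) (coeffFunctional S h)

theorem quadForm_apply [Fintype G] (c : G → G → S) (x : MonoidAlgebra S G) :
    quadForm c x = ∑ g, ∑ h, c g h * (x.coeff g * x.coeff h) := by
  simp [quadForm]

/-- A quadratic map on `S[G]` is determined by its values at `g` and `g + h`. -/
theorem quadraticMap_ext {N : Type*} [AddCommGroup N] [Module S N]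
    {Q₁ Q₂ : QuadraticMap S (MonoidAlgebra S G) N}
    (h₁ : ∀ g, Q₁ (MonoidAlgebra.single g 1) = Q₂ (MonoidAlgebra.single g 1))
    (h₂ : ∀ g h, g ≠ h → Q₁ (MonoidAlgebra.single g 1 + MonoidAlgebra.single h 1) =
      Q₂ (MonoidAlgebra.single g 1 + MonoidAlgebra.single h 1)) : Q₁ = Q₂ := by
  have hs : ∀ (g : G) (a : S),
      MonoidAlgebra.single g a = a • (MonoidAlgebra.single g 1 : MonoidAlgebra S G) := by
    intro g a; simp
  have hp : ∀ x y, QuadraticMap.polar Q₁ x y = QuadraticMap.polar Q₂ x y := by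
    intro x y
    induction x using MonoidAlgebra.induction_linear with
    | zero => simp
    | add x x' hx hx' => rw [QuadraticMap.polar_add_left, QuadraticMap.polar_add_left, hx, hx']
    | single g a =>
      induction y using MonoidAlgebra.induction_linear with
      | zero => simp
      | add x x' hx hx' => rw [QuadraticMap.polar_add_right, QuadraticMap.polar_add_right, hx, hx']
      | single h b =>
        rw [hs g, hs h]
        simp only [QuadraticMap.polar_smul_left, QuadraticMap.polar_smul_right]
        congr 2
        by_cases hgh : g = h
        · subst hgh
          rw [QuadraticMap.polar_self, QuadraticMap.polar_self, h₁]
        · rw [QuadraticMap.polar, QuadraticMap.polar, h₂ g h hgh, h₁, h₁]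
  ext x
  induction x using MonoidAlgebra.induction_linear with
  | zero => simp
  | add x y hx hy =>
    rw [QuadraticMap.map_add Q₁, QuadraticMap.map_add Q₂, hx, hy, hp]
  | single g a => rw [hs, QuadraticMap.map_smul, QuadraticMap.map_smul, h₁]

/-- Group elements and their pairwise sums lie in the image of `R[G]` whatever `ψ` is, and they
determine a quadratic map. -/
theorem quadraticMap_ext_mapRingHom {R N : Type*} [CommRing R] [Monoid G] [AddCommGroup N]
    [Module S N] (ψ : R →+* S) {Q₁ Q₂ : QuadraticMap S (MonoidAlgebra S G) N}
    (h : ∀ x : MonoidAlgebra R G, Q₁ (MonoidAlgebra.mapRingHom G ψ x) =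
      Q₂ (MonoidAlgebra.mapRingHom G ψ x)) : Q₁ = Q₂ := by
  refine quadraticMap_ext (fun g => ?_) (fun g g' _ => ?_)
  · simpa using h (MonoidAlgebra.single g 1)
  · have := h (MonoidAlgebra.single g 1 + MonoidAlgebra.single g' 1)
    rw [map_add] at this
    simpa using this

/-- A quadratic form on `S[G]` that is multiplicative on the image of `R[G]` is multiplicative. -/
theorem quadraticMap_map_mul {R : Type*} [CommRing R] [Monoid G] (ψ : R →+* S)
    (Q : QuadraticMap S (MonoidAlgebra S G) S)
    (h : ∀ x y : MonoidAlgebra R G, Q (MonoidAlgebra.mapRingHom G ψ (x * y)) =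
      Q (MonoidAlgebra.mapRingHom G ψ x) * Q (MonoidAlgebra.mapRingHom G ψ y))
    (x y : MonoidAlgebra S G) : Q (x * y) = Q x * Q y := by
  -- With one factor fixed, both sides are quadratic in the other. This frees `x` first, with `y`
  -- still in the image of `R[G]`, and then `y`.
  have h₁ : ∀ (y : MonoidAlgebra R G) (x : MonoidAlgebra S G),
      Q (x * MonoidAlgebra.mapRingHom G ψ y) = Q x * Q (MonoidAlgebra.mapRingHom G ψ y) := by
    intro y x
    have : Q.comp (LinearMap.mulRight S (MonoidAlgebra.mapRingHom G ψ y)) =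
        Q (MonoidAlgebra.mapRingHom G ψ y) • Q :=
      quadraticMap_ext_mapRingHom ψ fun x => by
        simp only [QuadraticMap.comp_apply, LinearMap.mulRight_apply, _root_.smul_apply,
          smul_eq_mul]
        rw [← map_mul, h, mul_comm]
    simpa [mul_comm] using DFunLike.congr_fun this x
  have : Q.comp (LinearMap.mulLeft S x) = Q x • Q :=
    quadraticMap_ext_mapRingHom ψ fun y => by simp [h₁]
  simpa using DFunLike.congr_fun this y

end QuadraticMaps

/-! ### Components of a determinant and their naturality. -/

section Eval

variable {A S T : Type u} [CommRing A] [CommRing S] [CommRing T] {G : Type w} [Group G] {d : ℕ}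

theorem Determinant.eval_one (D : Determinant A G d) (φ : A →+* S) : D.eval φ 1 = 1 := by
  let := φ.toAlgebra
  simp only [Determinant.eval]
  rw [_root_.map_one, D.map_one, _root_.map_one]

theorem Determinant.eval_mul (D : Determinant A G d) (φ : A →+* S) (x y : MonoidAlgebra S G) :
    D.eval φ (x * y) = D.eval φ x * D.eval φ y := by
  let := φ.toAlgebra
  simp only [Determinant.eval]
  rw [_root_.map_mul, D.map_mul, _root_.map_mul]

theorem Determinant.eval_smul (D : Determinant A G d) (φ : A →+* S) (b : S)
    (x : MonoidAlgebra S G) : D.eval φ (b • x) = b ^ d * D.eval φ x := by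
  let := φ.toAlgebra
  simp only [Determinant.eval]
  rw [_root_.map_smul, D.map_smul, _root_.map_smul, smul_eq_mul]

theorem Determinant.map_eval (D : Determinant A G d) (φ : A →+* S) (ψ : S →+* T)
    (x : MonoidAlgebra S G) :
    ψ (D.eval φ x) = D.eval (ψ.comp φ) (MonoidAlgebra.mapRingHom G ψ x) := by
  let i1 := φ.toAlgebra
  let i2 := (ψ.comp φ).toAlgebra
  let ψ' : S →ₐ[A] T := { ψ with commutes' := fun _ => rfl }
  have h1 : ∀ t : S ⊗[A] A, ψ (Algebra.TensorProduct.rid A S S t) =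
      Algebra.TensorProduct.rid A T T (ψ'.toLinearMap.rTensor A t) := by
    intro t
    induction t with
    | zero => simp
    | add a b ha hb => simp only [map_add, ha, hb]
    | tmul s a =>
      simp only [Algebra.TensorProduct.rid_tmul, LinearMap.rTensor_tmul]
      exact _root_.map_smul ψ' a s
  have h2 : ψ'.toLinearMap.rTensor (MonoidAlgebra A G) (toTensor A S G x) =
      toTensor A T G (MonoidAlgebra.mapRingHom G ψ x) := by
    induction x using MonoidAlgebra.induction_linear with
    | zero => simp
    | add x y hx hy => simp only [map_add, hx, hy]
    | single g a =>
      rw [toTensor_single, MonoidAlgebra.mapRingHom_single, toTensor_single]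
      rfl
  simp only [Determinant.eval]
  rw [h1, ← h2]
  congr 1
  exact congr_fun (D.law.isCompat' ψ') (toTensor A S G x)

end Eval

/-! ### Degree 2 determinants are given by quadratic forms. -/

section Coefficients

/-- Scaling all variables by `X` multiplies a monomial of degree `m` by `X ^ m`, so powers of `X`
separate the homogeneous components. -/
theorem coeff_aeval_X_mul_C {A σ : Type*} [CommRing A] (p : MvPolynomial σ A) (n : ℕ) :
    (MvPolynomial.aeval (fun i : σ => (Polynomial.X * Polynomial.C (MvPolynomial.X i) :
      Polynomial (MvPolynomial σ A))) p).coeff n = MvPolynomial.homogeneousComponent n p := by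
  induction p using MvPolynomial.induction_on' with
  | add p q hp hq => rw [map_add, Polynomial.coeff_add, hp, hq, map_add]
  | monomial m a =>
    have h : (MvPolynomial.aeval (fun i : σ => (Polynomial.X * Polynomial.C (MvPolynomial.X i) :
        Polynomial (MvPolynomial σ A)))) (MvPolynomial.monomial m a) =
        Polynomial.C (MvPolynomial.monomial m a) * Polynomial.X ^ m.degree := by
      rw [MvPolynomial.aeval_monomial, MvPolynomial.monomial_eq, map_mul, Finsupp.prod,
        Finsupp.prod, Finsupp.degree]
      simp only [mul_pow, Finset.prod_mul_distrib, Finset.prod_pow_eq_pow_sum, map_prod, map_pow]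
      rw [mul_comm (Polynomial.X ^ _), mul_assoc]
      rfl
    rw [h, Polynomial.coeff_C_mul_X_pow]
    split_ifs with hn
    · exact ((MvPolynomial.homogeneousComponent_of_mem
        (MvPolynomial.isHomogeneous_monomial a hn.symm)).trans (if_pos rfl)).symm
    · refine ((MvPolynomial.homogeneousComponent_of_mem
        (MvPolynomial.isHomogeneous_monomial a rfl)).trans (if_neg hn)).symm

theorem exists_sum_of_isHomogeneous_two {A σ : Type*} [CommRing A] [Fintype σ]
    {p : MvPolynomial σ A} (hp : p.IsHomogeneous 2) :
    ∃ c : σ → σ → A,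
      p = ∑ i, ∑ j, MvPolynomial.C (c i j) * (MvPolynomial.X i * MvPolynomial.X j) := by
  classical
  have hmono : ∀ m : σ →₀ ℕ, m.degree = 2 → ∀ a : A, ∃ c : σ → σ → A,
      MvPolynomial.monomial m a =
        ∑ i, ∑ j, MvPolynomial.C (c i j) * (MvPolynomial.X i * MvPolynomial.X j) := by
    intro m hm a
    obtain ⟨i, j, rfl⟩ : ∃ i j, m = Finsupp.single i 1 + Finsupp.single j 1 := by
      have hsplit : ∀ m : σ →₀ ℕ, m.degree ≠ 0 → ∃ i m', m = Finsupp.single i 1 + m' := by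
        intro m hm
        obtain ⟨i, hi⟩ := Finsupp.ne_iff.1 (mt (Finsupp.degree_eq_zero_iff m).2 hm)
        exact ⟨i, exists_add_of_le (Finsupp.single_le_iff.2 (Nat.one_le_iff_ne_zero.2 hi))⟩
      obtain ⟨i, m', rfl⟩ := hsplit m (by omega)
      have h2 : m'.degree = 1 := by
        rw [map_add, Finsupp.degree_single] at hm
        omega
      obtain ⟨j, m'', rfl⟩ := hsplit m' (by omega)
      rw [map_add, Finsupp.degree_single] at h2
      exact ⟨i, j, by rw [(Finsupp.degree_eq_zero_iff m'').1 (by omega), add_zero]⟩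
    refine ⟨fun i' j' => if i' = i ∧ j' = j then a else 0, ?_⟩
    rw [Finset.sum_eq_single i, Finset.sum_eq_single j]
    · simp only [and_self, if_true]
      rw [MvPolynomial.X, MvPolynomial.X, MvPolynomial.monomial_mul,
        MvPolynomial.C_mul_monomial]
      simp
    · intro b _ hb; simp [hb]
    · simp
    · intro b _ hb; simp [hb]
    · simp
  have hsum : ∀ s : Finset (σ →₀ ℕ), (∀ m ∈ s, m.degree = 2) → ∃ c : σ → σ → A,
      ∑ m ∈ s, MvPolynomial.monomial m (p.coeff m) =
        ∑ i, ∑ j, MvPolynomial.C (c i j) * (MvPolynomial.X i * MvPolynomial.X j) := by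
    intro s
    induction s using Finset.induction_on with
    | empty => exact fun _ => ⟨fun _ _ => 0, by simp⟩
    | insert m s hms ih =>
      intro hs
      obtain ⟨c, hc⟩ := ih fun m' hm' => hs m' (Finset.mem_insert_of_mem hm')
      obtain ⟨c', hc'⟩ := hmono m (hs m (Finset.mem_insert_self _ _)) (p.coeff m)
      refine ⟨fun i j => c' i j + c i j, ?_⟩
      rw [Finset.sum_insert hms, hc, hc']
      simp [add_mul, Finset.sum_add_distrib]
  obtain ⟨c, hc⟩ := hsum p.support fun m hm => by
    rw [Finsupp.degree_eq_weight_one]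
    exact hp (MvPolynomial.mem_support_iff.1 hm)
  exact ⟨c, by rw [← hc, MvPolynomial.support_sum_monomial_coeff]⟩

/-- The components of a determinant of degree `2` are quadratic forms with coefficients
independent of the algebra. -/
theorem Determinant.exists_eval_eq_quadForm {A : Type u} [CommRing A] {G : Type u} [Group G]
    [Fintype G] (D : Determinant A G 2) :
    ∃ c : G → G → A, ∀ (S : Type u) [CommRing S] (φ : A →+* S) (x : MonoidAlgebra S G),
      D.eval φ x = quadForm (fun g h => φ (c g h)) x := by
  let P := MvPolynomial G A
  -- The generic element of the group algebra: every `x` over every `S` is a specialization of it,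
  -- so by naturality the polynomial `p` determines all components.
  let ξ : MonoidAlgebra P G := ∑ g, MonoidAlgebra.single g (MvPolynomial.X g)
  let p : P := D.eval MvPolynomial.C ξ
  have hspec : ∀ (S : Type u) [CommRing S] (φ : A →+* S) (x : MonoidAlgebra S G),
      D.eval φ x = MvPolynomial.eval₂ φ (fun g => x.coeff g) p := by
    intro S _ φ x
    have := D.map_eval (MvPolynomial.C) (MvPolynomial.eval₂Hom φ (fun g => x.coeff g)) ξ
    rw [MvPolynomial.coe_eval₂Hom] at this
    rw [this]
    congr 1
    · ext a; simp
    · ext g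
      simp [ξ, map_sum, MonoidAlgebra.coeff_sum]
  have hp : p.IsHomogeneous 2 := by
    let Φ : P →ₐ[A] Polynomial P := MvPolynomial.aeval (fun i : G =>
      (Polynomial.X * Polynomial.C (MvPolynomial.X i) : Polynomial P))
    have hX : ∀ g, Φ (MvPolynomial.X g) = Polynomial.X * Polynomial.C (MvPolynomial.X g) :=
      fun g => MvPolynomial.aeval_X _ g
    -- `Φ` carries `ξ` to `X • ξ`, so naturality and homogeneity of `D` give `Φ p = X² p`. Comparing
    -- coefficients of `X²` shows that `p` is its own component of degree 2.
    have h1 := D.map_eval MvPolynomial.C (Φ : P →+* Polynomial P) ξ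
    have h2 := D.map_eval MvPolynomial.C (Polynomial.C : P →+* Polynomial P) ξ
    have h3 : MonoidAlgebra.mapRingHom G (Φ : P →+* Polynomial P) ξ =
        (Polynomial.X : Polynomial P) • MonoidAlgebra.mapRingHom G Polynomial.C ξ := by
      simp only [ξ, map_sum, Finset.smul_sum, MonoidAlgebra.mapRingHom_single,
        MonoidAlgebra.smul_single, RingHom.coe_coe, hX, smul_eq_mul]
    have h4 : (Φ : P →+* Polynomial P).comp MvPolynomial.C =
        (Polynomial.C : P →+* Polynomial P).comp MvPolynomial.C :=
      RingHom.ext fun a => MvPolynomial.aeval_C _ a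
    rw [h3, h4, D.eval_smul, ← h2] at h1
    have h5 := coeff_aeval_X_mul_C p 2
    rw [show (MvPolynomial.aeval _) p = _ from h1, Polynomial.coeff_X_pow_mul'] at h5
    have h6 : p = MvPolynomial.homogeneousComponent 2 p := by simpa using h5
    rw [h6]
    exact MvPolynomial.homogeneousComponent_isHomogeneous 2 p
  obtain ⟨c, hc⟩ := exists_sum_of_isHomogeneous_two hp
  refine ⟨c, fun S _ φ x => ?_⟩
  rw [hspec, hc, quadForm_apply]
  simp [MvPolynomial.eval₂_sum]

end Coefficients

/-! ### Symmetric tensors and their universal property. -/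

section SymmetricTensors

variable (k : Type*) [CommRing k] (G : Type*) [CommGroup G]

/-- The symmetric tensors in `k[G] ⊗ k[G] = k[G × G]`. -/
def symTensors : Subalgebra k (MonoidAlgebra k (G × G)) :=
  AlgHom.equalizer (MonoidAlgebra.domCongr k k (MulEquiv.prodComm : G × G ≃* G × G)).toAlgHom
    (AlgHom.id k _)

variable {k G}

theorem mem_symTensors_iff {x : MonoidAlgebra k (G × G)} :
    x ∈ symTensors k G ↔ ∀ g h, x.coeff (g, h) = x.coeff (h, g) := by
  change MonoidAlgebra.domCongr k k (MulEquiv.prodComm : G × G ≃* G × G) x = x ↔ _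
  constructor
  · intro hx g h
    conv_lhs => rw [← hx, MonoidAlgebra.coeff_domCongr]
    rfl
  · intro hx
    ext ⟨g, h⟩
    rw [MonoidAlgebra.coeff_domCongr]
    exact hx h g

variable (k G) in
/-- The homomorphism `x ↦ x ⊗ 1`. -/
def tensorInl : MonoidAlgebra k G →ₐ[k] MonoidAlgebra k (G × G) :=
  MonoidAlgebra.mapDomainAlgHom k k (MonoidHom.inl G G)

variable (k G) in
/-- The homomorphism `x ↦ 1 ⊗ x`. -/
def tensorInr : MonoidAlgebra k G →ₐ[k] MonoidAlgebra k (G × G) :=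
  MonoidAlgebra.mapDomainAlgHom k k (MonoidHom.inr G G)

@[simp]
theorem tensorInl_single (g : G) (a : k) :
    tensorInl k G (MonoidAlgebra.single g a) = MonoidAlgebra.single (g, 1) a := by
  simp [tensorInl]

@[simp]
theorem tensorInr_single (g : G) (a : k) :
    tensorInr k G (MonoidAlgebra.single g a) = MonoidAlgebra.single (1, g) a := by
  simp [tensorInr]

theorem domCongr_tensorInl (x : MonoidAlgebra k G) :
    MonoidAlgebra.domCongr k k (MulEquiv.prodComm : G × G ≃* G × G) (tensorInl k G x) =
      tensorInr k G x := by
  have : (MonoidAlgebra.domCongr k k (MulEquiv.prodComm : G × G ≃* G × G)).toAlgHom.comp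
      (tensorInl k G) = tensorInr k G := by
    ext g : 2
    simp [MonoidAlgebra.domCongr_single]
  exact DFunLike.congr_fun this x

theorem domCongr_tensorInr (x : MonoidAlgebra k G) :
    MonoidAlgebra.domCongr k k (MulEquiv.prodComm : G × G ≃* G × G) (tensorInr k G x) =
      tensorInl k G x := by
  have : (MonoidAlgebra.domCongr k k (MulEquiv.prodComm : G × G ≃* G × G)).toAlgHom.comp
      (tensorInr k G) = tensorInl k G := by
    ext g : 2
    simp [MonoidAlgebra.domCongr_single]
  exact DFunLike.congr_fun this x

/-- The bilinear map `(x, y) ↦ x ⊗ y + y ⊗ x` to the symmetric tensors. -/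
def symPolar : LinearMap.BilinMap k (MonoidAlgebra k G) (symTensors k G) :=
  LinearMap.mk₂ k
    (fun x y => ⟨tensorInl k G x * tensorInr k G y + tensorInl k G y * tensorInr k G x, by
      change MonoidAlgebra.domCongr k k (MulEquiv.prodComm : G × G ≃* G × G) _ = _
      rw [map_add, map_mul, map_mul, domCongr_tensorInl, domCongr_tensorInl, domCongr_tensorInr,
        domCongr_tensorInr]
      simp only [AlgHom.coe_id, id]
      ring⟩)
    (fun x y z => Subtype.ext (by simp [add_mul, mul_add]; ring))
    (fun a x z => Subtype.ext (by simp))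
    (fun x y z => Subtype.ext (by simp [add_mul, mul_add]; ring))
    (fun a x z => Subtype.ext (by simp))

variable (k G) in
/-- The quadratic map `x ↦ x ⊗ x` to the symmetric tensors. -/
def symSquare : QuadraticMap k (MonoidAlgebra k G) (symTensors k G) where
  toFun x := ⟨tensorInl k G x * tensorInr k G x, by
      change MonoidAlgebra.domCongr k k (MulEquiv.prodComm : G × G ≃* G × G) _ = _
      rw [map_mul, domCongr_tensorInl, domCongr_tensorInr, mul_comm]
      rfl⟩
  toFun_smul a x := Subtype.ext (by simp [mul_smul])
  exists_companion' := ⟨symPolar, fun x y => Subtype.ext (by simp [symPolar]; ring)⟩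

theorem coe_symSquare (x : MonoidAlgebra k G) :
    (symSquare k G x : MonoidAlgebra k (G × G)) = tensorInl k G x * tensorInr k G x := rfl

theorem symSquare_one : symSquare k G 1 = 1 := Subtype.ext (by simp [coe_symSquare])

theorem symSquare_mul (x y : MonoidAlgebra k G) :
    symSquare k G (x * y) = symSquare k G x * symSquare k G y :=
  Subtype.ext (by simp only [coe_symSquare, map_mul, MulMemClass.coe_mul]; ring)

theorem coe_polar_symSquare (x y : MonoidAlgebra k G) :
    ((QuadraticMap.polar (symSquare k G) x y : symTensors k G) : MonoidAlgebra k (G × G)) =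
      tensorInl k G x * tensorInr k G y + tensorInl k G y * tensorInr k G x := by
  simp only [QuadraticMap.polar, AddSubgroupClass.coe_sub, coe_symSquare, map_add]
  ring

variable (k G) in
/-- Symmetric tensors as functions on unordered pairs. -/
def symTensorsEquiv [Finite G] : symTensors k G ≃ₗ[k] (Sym2 G → k) where
  toFun u := Sym2.lift ⟨fun a b => (u : MonoidAlgebra k (G × G)).coeff (a, b),
    mem_symTensors_iff.1 u.2⟩
  map_add' u v := by
    ext z
    induction z with | _ a b => simp
  map_smul' c u := by
    ext z
    induction z with | _ a b => simp
  invFun v := ⟨MonoidAlgebra.ofCoeff (Finsupp.equivFunOnFinite.symm fun p => v s(p.1, p.2)), by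
    rw [mem_symTensors_iff]
    intro g h
    simp [Sym2.eq_swap]⟩
  left_inv u := by
    ext ⟨a, b⟩
    simp
  right_inv v := by
    ext z
    induction z with | _ a b => simp

variable (k G) in
/-- The basis of orbit sums of the symmetric tensors. -/
def symTensorsBasis [Finite G] : Module.Basis (Sym2 G) k (symTensors k G) :=
  Module.Basis.ofEquivFun (symTensorsEquiv k G)

theorem symTensorsBasis_diag [Finite G] (g : G) :
    symTensorsBasis k G s(g, g) = symSquare k G (MonoidAlgebra.single g 1) := by
  classical
  apply (symTensorsEquiv k G).injective
  rw [symTensorsBasis, Module.Basis.coe_ofEquivFun, LinearEquiv.apply_symm_apply]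
  ext z
  induction z with | _ a b =>
  simp [symTensorsEquiv, coe_symSquare, Finsupp.single_apply,
    Pi.single_apply, MonoidAlgebra.single_mul_single]
  simp only [eq_comm]

/-- The orbit sum `g ⊗ h + h ⊗ g` is a polarization of the square map, so no division by 2 is needed
to reach it from squares. -/
theorem symTensorsBasis_of_ne [Finite G] {g h : G} (hgh : g ≠ h) :
    symTensorsBasis k G s(g, h) = QuadraticMap.polar (symSquare k G) (MonoidAlgebra.single g 1)
      (MonoidAlgebra.single h 1) := by
  classical
  apply (symTensorsEquiv k G).injective
  rw [symTensorsBasis, Module.Basis.coe_ofEquivFun, LinearEquiv.apply_symm_apply]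
  ext z
  induction z with | _ a b =>
  simp [symTensorsEquiv, coe_polar_symSquare, Finsupp.single_apply,
    Pi.single_apply, MonoidAlgebra.single_mul_single]
  grind

theorem span_range_symSquare [Finite G] :
    Submodule.span k (Set.range (symSquare k G)) = ⊤ := by
  rw [← top_le_iff, ← (symTensorsBasis k G).span_eq, Submodule.span_le]
  rintro _ ⟨z, rfl⟩
  have h : ∀ x, symSquare k G x ∈ Submodule.span k (Set.range (symSquare k G)) := fun x =>
    Submodule.subset_span ⟨x, rfl⟩
  induction z with | _ a b =>
  by_cases hab : a = b
  · subst hab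
    rw [symTensorsBasis_diag]
    exact h _
  · rw [symTensorsBasis_of_ne hab]
    exact sub_mem (sub_mem (h _) (h _)) (h _)

theorem symTensors_linearMap_ext [Finite G] {A : Type*} [AddCommGroup A] [Module k A]
    {f f' : symTensors k G →ₗ[k] A} (h : ∀ x, f (symSquare k G x) = f' (symSquare k G x)) :
    f = f' := by
  refine LinearMap.ext_on_range (v := symSquare k G) span_range_symSquare h

theorem symTensors_algHom_ext [Finite G] {A : Type*} [CommRing A] [Algebra k A]
    {f f' : symTensors k G →ₐ[k] A} (h : ∀ x, f (symSquare k G x) = f' (symSquare k G x)) :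
    f = f' :=
  AlgHom.toLinearMap_injective (symTensors_linearMap_ext h)

/-- A linear map is prescribed freely on the basis of orbit sums: values of `q` on the diagonal and
of its polar form, which is symmetric, elsewhere. -/
theorem exists_linearMap_symSquare [Finite G] {A : Type*} [AddCommGroup A] [Module k A]
    (q : QuadraticMap k (MonoidAlgebra k G) A) :
    ∃ θ : symTensors k G →ₗ[k] A, ∀ x, θ (symSquare k G x) = q x := by
  classical
  let θ : symTensors k G →ₗ[k] A := (symTensorsBasis k G).constr k (Sym2.lift
    ⟨fun a b => if a = b then q (MonoidAlgebra.single a 1) else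
      QuadraticMap.polar q (MonoidAlgebra.single a 1) (MonoidAlgebra.single b 1), fun a b => by
        by_cases h : a = b
        · simp [h]
        · simp [h, Ne.symm h, QuadraticMap.polar_comm]⟩)
  have hd : ∀ g, θ (symSquare k G (MonoidAlgebra.single g 1)) = q (MonoidAlgebra.single g 1) := by
    intro g
    rw [← symTensorsBasis_diag, Module.Basis.constr_basis]
    simp
  have : θ.compQuadraticMap (symSquare k G) = q := by
    refine quadraticMap_ext hd fun g h hgh => ?_
    have := congr_arg θ (symTensorsBasis_of_ne (k := k) hgh)
    rw [Module.Basis.constr_basis] at this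
    simp only [Sym2.lift_mk, if_neg hgh, QuadraticMap.polar, map_sub, hd] at this
    simpa using this.symm
  exact ⟨θ, DFunLike.congr_fun this⟩

/-- The symmetric tensors are universal for multiplicative quadratic maps on `k[G]`. -/
theorem exists_algHom_symSquare [Finite G] {A : Type*} [CommRing A] [Algebra k A]
    (q : QuadraticMap k (MonoidAlgebra k G) A) (h1 : q 1 = 1)
    (hm : ∀ x y, q (x * y) = q x * q y) :
    ∃ θ : symTensors k G →ₐ[k] A, ∀ x, θ (symSquare k G x) = q x := by
  obtain ⟨θ, hθ⟩ := exists_linearMap_symSquare q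
  -- Squares span, so multiplicativity is extended from squares to all tensors in one argument at a
  -- time.
  have h : ∀ x u, θ (symSquare k G x * u) = q x * θ u := by
    intro x
    have : θ ∘ₗ LinearMap.mulLeft k (symSquare k G x) = LinearMap.mulLeft k (q x) ∘ₗ θ :=
      symTensors_linearMap_ext fun y => by
        simp only [LinearMap.comp_apply, LinearMap.mulLeft_apply, ← symSquare_mul, hθ, hm]
    exact DFunLike.congr_fun this
  refine ⟨AlgHom.ofLinearMap θ (by rw [← symSquare_one, hθ, h1]) fun u v => ?_, hθ⟩
  have : θ ∘ₗ LinearMap.mulRight k v = LinearMap.mulRight k (θ v) ∘ₗ θ :=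
    symTensors_linearMap_ext fun y => by
      simp only [LinearMap.comp_apply, LinearMap.mulRight_apply, h, hθ]
  exact DFunLike.congr_fun this u

variable (k G) in
/-- The coefficients of the quadratic map `symSquare` for a (nonsymmetric) bilinear form. -/
theorem exists_symSquare_eq_sum [Fintype G] : ∃ c : G → G → symTensors k G,
    ∀ x, symSquare k G x = ∑ g, ∑ h, (x.coeff g * x.coeff h) • c g h := by
  -- On the free module `k[G]` every quadratic map is the diagonal of some bilinear map, not
  -- necessarily symmetric.
  obtain ⟨B, hB⟩ := LinearMap.BilinMap.toQuadraticMap_surjective (symSquare k G)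
  refine ⟨fun g h => B (MonoidAlgebra.single g 1) (MonoidAlgebra.single h 1), fun x => ?_⟩
  have hx : x = ∑ g, x.coeff g • (MonoidAlgebra.single g 1 : MonoidAlgebra k G) := by
    ext g
    simp [MonoidAlgebra.coeff_sum]
  rw [← hB]
  conv_lhs => rw [hx]
  simp only [LinearMap.BilinMap.toQuadraticMap_apply, map_sum, LinearMap.sum_apply, map_smul,
    LinearMap.smul_apply, mul_smul, Finset.smul_sum]
  rw [Finset.sum_comm]
  refine Finset.sum_congr rfl fun g _ => Finset.sum_congr rfl fun h _ => smul_comm _ _ _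

end SymmetricTensors

/-! ### Determinants built from coefficients. -/

section OfCoeffs

variable {A : Type u} [CommRing A] {G : Type w} [Group G] [Fintype G]

/-- The coefficient of `g`, as an `S`-linear functional on `S ⊗ A[G]`. -/
def tensorCoeff (A S : Type*) [CommRing A] [CommSemiring S] [Algebra A S] {G : Type*} (g : G) :
    S ⊗[A] MonoidAlgebra A G →ₗ[S] S :=
  (TensorProduct.AlgebraTensorModule.rid A S S).toLinearMap ∘ₗ
    (coeffFunctional A g).baseChange S

theorem tensorCoeff_tmul (A S : Type*) [CommRing A] [CommSemiring S] [Algebra A S] {G : Type*}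
    (g : G) (s : S) (x : MonoidAlgebra A G) : tensorCoeff A S g (s ⊗ₜ x) = x.coeff g • s := by
  simp [tensorCoeff]

theorem tensorCoeff_toTensor (A S : Type u) [CommRing A] [CommRing S] [Algebra A S] {G : Type w}
    [Group G] (g : G) (x : MonoidAlgebra S G) :
    tensorCoeff A S g (toTensor A S G x) = x.coeff g := by
  classical
  induction x using MonoidAlgebra.induction_linear with
  | zero => simp
  | add x y hx hy => simp [hx, hy]
  | single h s =>
    rw [toTensor_single, tensorCoeff_tmul]
    simp [Finsupp.single_apply]

/-- The polynomial law `∑ c g h x_g x_h`. -/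
def quadLaw (c : G → G → A) : MonoidAlgebra A G →ₚₗ[A] A where
  toFun' S _ _ t :=
    (∑ g, ∑ h, algebraMap A S (c g h) * (tensorCoeff A S g t * tensorCoeff A S h t)) ⊗ₜ 1
  isCompat' {S} _ _ {S'} _ _ φ := by
    have h : ∀ (g : G) (t : S ⊗[A] MonoidAlgebra A G), tensorCoeff A S' g
        (φ.toLinearMap.rTensor (MonoidAlgebra A G) t) = φ (tensorCoeff A S g t) := by
      intro g t
      induction t with
      | zero => simp
      | add x y hx hy => simp only [map_add, hx, hy]
      | tmul s x => simp [tensorCoeff_tmul]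
    funext t
    simp [h]

/-- The determinant of degree `2` with components `∑ c g h x_g x_h`. -/
def Determinant.ofCoeffs (c : G → G → A)
    (h1 : ∀ (S : Type u) [CommRing S] (φ : A →+* S), quadForm (fun g h => φ (c g h)) 1 = 1)
    (hm : ∀ (S : Type u) [CommRing S] (φ : A →+* S) (x y : MonoidAlgebra S G),
      quadForm (fun g h => φ (c g h)) (x * y) =
        quadForm (fun g h => φ (c g h)) x * quadForm (fun g h => φ (c g h)) y) :
    Determinant A G 2 :=
  have key : ∀ (S : Type u) [CommRing S] [Algebra A S] (x : MonoidAlgebra S G),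
      (quadLaw c).toFun' S (toTensor A S G x) =
        (quadForm (fun g h => algebraMap A S (c g h)) x) ⊗ₜ 1 := by
    intro S _ _ x
    simp only [quadLaw, tensorCoeff_toTensor, quadForm_apply]
  { law := quadLaw c
    map_one := fun S _ _ => by
      rw [← _root_.map_one (toTensor A S G), key, h1 S (algebraMap A S)]
      rfl
    map_mul := fun S _ _ x y => by
      obtain ⟨x, rfl⟩ := (toTensor_bijective A S G).2 x
      obtain ⟨y, rfl⟩ := (toTensor_bijective A S G).2 y
      rw [← _root_.map_mul, key, key, key, hm S (algebraMap A S),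
        Algebra.TensorProduct.tmul_mul_tmul, one_mul]
    map_smul := fun S _ _ b x => by
      obtain ⟨x, rfl⟩ := (toTensor_bijective A S G).2 x
      rw [← _root_.map_smul, key, key, QuadraticMap.map_smul, TensorProduct.smul_tmul', sq] }

theorem Determinant.eval_ofCoeffs (c : G → G → A) (h1 hm) (S : Type u) [CommRing S] (φ : A →+* S)
    (x : MonoidAlgebra S G) :
    (Determinant.ofCoeffs c h1 hm).eval φ x = quadForm (fun g h => φ (c g h)) x := by
  let := φ.toAlgebra
  simp only [Determinant.eval, Determinant.ofCoeffs, quadLaw, tensorCoeff_toTensor, quadForm_apply]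
  simp only [Algebra.TensorProduct.rid_tmul, one_smul]
  rfl

end OfCoeffs

/-! ### Determinants as homomorphisms from the symmetric tensors. -/

section Classification

variable {k : Type} [CommRing k] {G : Type u} [CommGroup G] [Finite G]
variable {A : Type u} [CommRing A] [Algebra k A]

/-- The composition of a determinant of degree `2` with `k[G] → S[G]`. -/
theorem Determinant.exists_quadraticMap (D : Determinant A G 2) :
    ∃ q : QuadraticMap k (MonoidAlgebra k G) A, ∀ x,
      q x = D.eval (RingHom.id A) (MonoidAlgebra.mapRingHom G (algebraMap k A) x) := by
  have := Fintype.ofFinite G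
  obtain ⟨c, hc⟩ := D.exists_eval_eq_quadForm
  refine ⟨((quadForm c).restrictScalars (S := k)).comp
    (MonoidAlgebra.mapAlgHom G (Algebra.ofId k A)).toLinearMap, fun x => ?_⟩
  rw [hc]
  rfl

omit [Algebra k A] in
/-- A component of a determinant of degree `2` is determined by its values on the image of
`k[G]`. -/
theorem Determinant.eval_eq_quadForm_of_mapRingHom {S : Type u} [CommRing S] [Algebra k S]
    (D : Determinant A G 2) (φ : A →+* S) (Q : QuadraticMap S (MonoidAlgebra S G) S)
    (h : ∀ x : MonoidAlgebra k G, D.eval φ (MonoidAlgebra.mapRingHom G (algebraMap k S) x) =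
      Q (MonoidAlgebra.mapRingHom G (algebraMap k S) x)) (x : MonoidAlgebra S G) :
    D.eval φ x = Q x := by
  have := Fintype.ofFinite G
  obtain ⟨c, hc⟩ := D.exists_eval_eq_quadForm
  rw [hc]
  refine DFunLike.congr_fun (quadraticMap_ext_mapRingHom (algebraMap k S) fun x => ?_) x
  rw [← hc, h]

/-- The determinant of degree `2` classified by a homomorphism from the symmetric tensors. -/
theorem exists_determinant (θ : symTensors k G →ₐ[k] A) :
    ∃ D : Determinant A G 2, ∀ (S : Type u) [CommRing S] (φ : A →+* S) (x : MonoidAlgebra k G),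
      D.eval φ (MonoidAlgebra.mapRingHom G (φ.comp (algebraMap k A)) x) =
        φ (θ (symSquare k G x)) := by
  have := Fintype.ofFinite G
  obtain ⟨c, hc⟩ := exists_symSquare_eq_sum k G
  have key : ∀ (S : Type u) [CommRing S] (φ : A →+* S) (x : MonoidAlgebra k G),
      quadForm (fun g h => φ (θ (c g h)))
        (MonoidAlgebra.mapRingHom G (φ.comp (algebraMap k A)) x) = φ (θ (symSquare k G x)) := by
    intro S _ φ x
    rw [quadForm_apply, hc]
    simp [Algebra.smul_def, mul_comm]
  refine ⟨Determinant.ofCoeffs (fun g h => θ (c g h)) (fun S _ φ => ?_) (fun S _ φ => ?_),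
    fun S _ φ x => ?_⟩
  · have := key S φ 1
    rwa [symSquare_one, map_one θ, map_one φ, map_one (MonoidAlgebra.mapRingHom G _)] at this
  · refine quadraticMap_map_mul (φ.comp (algebraMap k A)) _ fun x y => ?_
    rw [key, key, key, symSquare_mul, map_mul, map_mul]
  · rw [Determinant.eval_ofCoeffs, key]

/-- The determinant of degree `2` classified by a homomorphism from the symmetric tensors. -/
def determinantOf (θ : symTensors k G →ₐ[k] A) : Determinant A G 2 :=
  (exists_determinant θ).choose

theorem eval_determinantOf (θ : symTensors k G →ₐ[k] A) {S : Type u} [CommRing S] (φ : A →+* S)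
    (x : MonoidAlgebra k G) :
    (determinantOf θ).eval φ (MonoidAlgebra.mapRingHom G (φ.comp (algebraMap k A)) x) =
        φ (θ (symSquare k G x)) :=
  (exists_determinant θ).choose_spec S φ x

/-- Every determinant of degree `2` is classified by a homomorphism. -/
theorem Determinant.exists_algHom (D : Determinant A G 2) :
    ∃ θ : symTensors k G →ₐ[k] A, ∀ x, θ (symSquare k G x) =
      D.eval (RingHom.id A) (MonoidAlgebra.mapRingHom G (algebraMap k A) x) := by
  obtain ⟨q, hq⟩ := D.exists_quadraticMap (k := k)
  obtain ⟨θ, hθ⟩ := exists_algHom_symSquare q (by rw [hq, _root_.map_one, D.eval_one])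
    (fun x y => by rw [hq, hq, hq, _root_.map_mul, D.eval_mul])
  exact ⟨θ, fun x => by rw [hθ, hq]⟩

/-- `D` is classified by the homomorphism `θ` from the symmetric tensors. -/
def Determinant.IsClassifiedBy (D : Determinant A G 2) (θ : symTensors k G →ₐ[k] A) : Prop :=
  ∀ x, θ (symSquare k G x) =
      D.eval (RingHom.id A) (MonoidAlgebra.mapRingHom G (algebraMap k A) x)

theorem determinantOf_isClassifiedBy (θ : symTensors k G →ₐ[k] A) :
    (determinantOf θ).IsClassifiedBy θ := fun x =>
  (eval_determinantOf θ (RingHom.id A) x).symm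

omit [Finite G] in
theorem Determinant.IsClassifiedBy.eval {D : Determinant A G 2} {θ : symTensors k G →ₐ[k] A}
    (h : D.IsClassifiedBy θ) {S : Type u} [CommRing S] (φ : A →+* S) (x : MonoidAlgebra k G) :
    D.eval φ (MonoidAlgebra.mapRingHom G (φ.comp (algebraMap k A)) x) =
      φ (θ (symSquare k G x)) := by
  rw [h, D.map_eval]
  rw [RingHom.comp_id, ← RingHom.comp_apply, ← MonoidAlgebra.mapRingHom_comp]

/-- Forwards, test at the identity of `B`, since a homomorphism is known from its values on squares.
Backwards, components over `S` are quadratic, hence determined on the image of `k[G]`, where both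
are computed by `f ∘ θ`. -/
theorem Determinant.IsClassifiedBy.isBaseChange_iff {B : Type u} [CommRing B] [Algebra k B]
    {D : Determinant A G 2} {θ : symTensors k G →ₐ[k] A} (h : D.IsClassifiedBy θ)
    {E : Determinant B G 2} {η : symTensors k G →ₐ[k] B} (hE : E.IsClassifiedBy η)
    (f : A →ₐ[k] B) : D.IsBaseChange (f : A →+* B) E ↔ f.comp θ = η := by
  have := Fintype.ofFinite G
  constructor
  · intro hb
    refine symTensors_algHom_ext fun x => ?_
    rw [hE, hb, AlgHom.comp_apply]
    have := h.eval (f : A →+* B) x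
    rw [f.comp_algebraMap] at this
    exact this.symm
  · rintro rfl S _ φ x
    let : Algebra k S := (φ.comp (algebraMap k B)).toAlgebra
    obtain ⟨c, hc⟩ := D.exists_eval_eq_quadForm
    rw [hc]
    refine E.eval_eq_quadForm_of_mapRingHom (k := k) φ _ (fun y => ?_) x
    rw [← hc]
    refine (hE.eval φ y).trans ?_
    have := h.eval (φ.comp (f : A →+* B)) y
    rw [RingHom.comp_assoc, f.comp_algebraMap] at this
    exact this.symm

omit [Finite G] in
/-- The linear extension of a two-dimensional representation, composed with the determinant, is
a quadratic form. -/
theorem exists_det_linExt_eq_quadForm [Fintype G] {S : Type u} [CommRing S] (φ : A →+* S)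
    (ρ : G →* GL (Fin 2) A) :
    ∃ c : G → G → S, ∀ x, (linExt φ ρ x).det = quadForm c x := by
  refine ⟨fun g h => φ (ρ g 0 0) * φ (ρ h 1 1) - φ (ρ g 0 1) * φ (ρ h 1 0), fun x => ?_⟩
  have : ∀ i j, linExt φ ρ x i j = ∑ g, x.coeff g * φ (ρ g i j) := by
    intro i j
    rw [linExt, MonoidAlgebra.lift_apply, Finsupp.sum_fintype _ _ (by simp), Matrix.sum_apply]
    rfl
  rw [Matrix.det_fin_two, this, this, this, this, quadForm_apply, Finset.sum_mul_sum,
    Finset.sum_mul_sum, ← Finset.sum_sub_distrib]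
  refine Finset.sum_congr rfl fun g _ => ?_
  rw [← Finset.sum_sub_distrib]
  exact Finset.sum_congr rfl fun h _ => by ring

omit [Finite G] in
theorem linExt_mapRingHom {B S T : Type u} [CommRing B] [CommRing S] [CommRing T] {d : ℕ}
    (φ : B →+* S) (ψ : S →+* T) (ρ : G →* GL (Fin d) B) (x : MonoidAlgebra S G) :
    linExt (ψ.comp φ) ρ (MonoidAlgebra.mapRingHom G ψ x) = ψ.mapMatrix (linExt φ ρ x) := by
  induction x using MonoidAlgebra.induction_linear with
  | zero => simp
  | add x y hx hy => simp only [map_add, hx, hy]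
  | single g a =>
    rw [MonoidAlgebra.mapRingHom_single, linExt, linExt, MonoidAlgebra.lift_single,
      MonoidAlgebra.lift_single]
    ext i j
    simp

omit [Finite G] in
theorem det_linExt_mapRingHom {B S T : Type u} [CommRing B] [CommRing S] [CommRing T] {d : ℕ}
    (φ : B →+* S) (ψ : S →+* T) (ρ : G →* GL (Fin d) B) (x : MonoidAlgebra S G) :
    (linExt (ψ.comp φ) ρ (MonoidAlgebra.mapRingHom G ψ x)).det = ψ (linExt φ ρ x).det := by
  rw [linExt_mapRingHom, RingHom.map_det]

/-- The homomorphism `θ` classifies the determinant of the representation `ρ`. -/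
def ClassifiesRep (θ : symTensors k G →ₐ[k] A) (ρ : G →* GL (Fin 2) A) : Prop :=
  ∀ x, θ (symSquare k G x) =
    (linExt (RingHom.id A) ρ (MonoidAlgebra.mapRingHom G (algebraMap k A) x)).det

theorem exists_classifiesRep (ρ : G →* GL (Fin 2) A) :
    ∃ θ : symTensors k G →ₐ[k] A, ClassifiesRep θ ρ := by
  have := Fintype.ofFinite G
  obtain ⟨c, hc⟩ := exists_det_linExt_eq_quadForm (RingHom.id A) ρ
  obtain ⟨θ, hθ⟩ := exists_algHom_symSquare (((quadForm c).restrictScalars (S := k)).comp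
    (MonoidAlgebra.mapAlgHom G (Algebra.ofId k A)).toLinearMap) (by
      refine (hc _).symm.trans ?_
      simp) (fun x y => by
      refine (hc _).symm.trans ?_
      refine Eq.trans ?_ (congr_arg₂ _ (hc _) (hc _))
      simp)
  refine ⟨θ, fun x => ?_⟩
  rw [hθ, hc]
  rfl

/-- Both sides are quadratic forms on `S[G]`, so it suffices to compare them on the image of `k[G]`.
The map `f` is only a ring homomorphism so that `residue A` qualifies. -/
theorem ClassifiesRep.baseChangesToRep {B : Type u} [CommRing B] [Algebra k B]
    {D : Determinant A G 2} {θ : symTensors k G →ₐ[k] A} (h : D.IsClassifiedBy θ)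
    {ρ : G →* GL (Fin 2) B} {η : symTensors k G →ₐ[k] B} (hρ : ClassifiesRep η ρ)
    {f : A →+* B} (hf : ∀ u, f (θ u) = η u) (hfk : f.comp (algebraMap k A) = algebraMap k B) :
    D.BaseChangesToRep f ρ := by
  have := Fintype.ofFinite G
  intro S _ φ x
  let : Algebra k S := (φ.comp (algebraMap k B)).toAlgebra
  obtain ⟨c, hc⟩ := exists_det_linExt_eq_quadForm φ ρ
  rw [hc]
  refine D.eval_eq_quadForm_of_mapRingHom (k := k) _ _ (fun y => ?_) x
  rw [← hc]
  have h1 := h.eval (φ.comp f) y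
  rw [RingHom.comp_assoc, hfk] at h1
  refine h1.trans ?_
  rw [RingHom.comp_apply, hf, hρ, ← det_linExt_mapRingHom, RingHom.comp_id,
    ← RingHom.comp_apply, ← MonoidAlgebra.mapRingHom_comp]
  rfl

omit [Finite G] in
theorem ClassifiesRep.comp {B : Type u} [CommRing B] [Algebra k B]
    {ρ : G →* GL (Fin 2) A} {θ : symTensors k G →ₐ[k] A} (h : ClassifiesRep θ ρ)
    (f : A →ₐ[k] B) :
    ClassifiesRep (f.comp θ) ((Matrix.GeneralLinearGroup.map (f : A →+* B)).comp ρ) := by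
  intro x
  rw [AlgHom.comp_apply, h]
  refine (det_linExt_mapRingHom (RingHom.id A) (f : A →+* B) ρ _).symm.trans ?_
  rw [← RingHom.comp_apply, ← MonoidAlgebra.mapRingHom_comp, f.comp_algebraMap]
  rfl

omit [Finite G] in
theorem ClassifiesRep.apply_single {ρ : G →* GL (Fin 2) A} {θ : symTensors k G →ₐ[k] A}
    (h : ClassifiesRep θ ρ) (g : G) :
    θ (symSquare k G (MonoidAlgebra.single g 1)) = (ρ g : Matrix (Fin 2) (Fin 2) A).det := by
  rw [h, MonoidAlgebra.mapRingHom_single, linExt, MonoidAlgebra.lift_single, map_one, one_smul]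
  rfl

omit [Finite G] in
theorem ClassifiesRep.apply_single_add_single {ρ : G →* GL (Fin 2) A}
    {θ : symTensors k G →ₐ[k] A} (h : ClassifiesRep θ ρ) (g g' : G) :
    θ (symSquare k G (MonoidAlgebra.single g 1 + MonoidAlgebra.single g' 1)) =
      ((ρ g : Matrix (Fin 2) (Fin 2) A) + (ρ g' : Matrix (Fin 2) (Fin 2) A)).det := by
  rw [h, map_add, MonoidAlgebra.mapRingHom_single, MonoidAlgebra.mapRingHom_single, linExt,
    map_add, MonoidAlgebra.lift_single, MonoidAlgebra.lift_single, map_one, one_smul, one_smul]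
  rfl

/-- Factor `MN + N = (M + 1)N` and expand `det (M + 1) = det M + tr M + 1`. This turns polarized
determinants into traces. -/
theorem det_add_det_fin_two {A : Type*} [CommRing A] (M N : Matrix (Fin 2) (Fin 2) A) :
    (M * N + N).det - (M * N).det - N.det = M.trace * N.det := by
  have : M * N + N = (M + 1) * N := by rw [add_mul, one_mul]
  rw [this, Matrix.det_mul, Matrix.det_mul, Matrix.det_fin_two (M + 1), Matrix.det_fin_two M,
    Matrix.trace_fin_two]
  simp
  ring

end Classification

/-! ### Finite local `ℤ₂`-algebras and group algebras of 2-groups. -/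

section LocalRings

/-- A finite local `ℤ₂`-algebra with residue field `𝔽₂` is a complete Noetherian local ring. -/
theorem isProCoeffRing_of_finite {R : Type u} [CommRing R] [IsLocalRing R] [Algebra ℤ_[2] R]
    [Module.Finite ℤ_[2] R] (h : R →+* ZMod 2) : IsProCoeffRing 2 R where
  noetherian := IsNoetherianRing.of_finite ℤ_[2] R
  complete := by
    have hN : IsNoetherianRing R := IsNoetherianRing.of_finite ℤ_[2] R
    have h1 : IsPrecomplete (maximalIdeal ℤ_[2]) R := isPrecomplete_of_finite _
    have h2 : IsPrecomplete ((maximalIdeal ℤ_[2]).map (algebraMap ℤ_[2] R)) R :=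
      IsPrecomplete.map_algebraMap_iff.2 h1
    have hle : (maximalIdeal ℤ_[2]).map (algebraMap ℤ_[2] R) ≤ maximalIdeal R := by
      refine Ideal.map_le_iff_le_comap.2 fun x hx => ?_
      rw [Ideal.mem_comap, mem_maximalIdeal_iff_of_ringHom_zmod_two h]
      exact (mem_maximalIdeal_iff_of_ringHom_zmod_two (h.comp (algebraMap ℤ_[2] R)) x).1 hx
    -- A prime containing the image of the maximal ideal of `ℤ₂` contracts to that ideal, so by
    -- integrality it is maximal. Hence a power of the maximal ideal of `R` lies in the extended
    -- ideal, and completeness transfers.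
    have hrad : maximalIdeal R ≤ ((maximalIdeal ℤ_[2]).map (algebraMap ℤ_[2] R)).radical := by
      rw [Ideal.radical_eq_sInf]
      refine le_sInf fun P ⟨hP, hPp⟩ => ?_
      have : P.IsMaximal := by
        refine Ideal.isMaximal_of_isIntegral_of_isMaximal_comap (R := ℤ_[2]) P ?_
        have hc : (P.comap (algebraMap ℤ_[2] R)).IsPrime := inferInstance
        rw [← (maximalIdeal.isMaximal ℤ_[2]).eq_of_le hc.ne_top (Ideal.map_le_iff_le_comap.1 hP)]
        exact maximalIdeal.isMaximal ℤ_[2]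
      rw [IsLocalRing.eq_maximalIdeal this]
    obtain ⟨k, hk⟩ := Ideal.exists_pow_le_of_le_radical_of_fg hrad (IsNoetherian.noetherian _)
    have h3 : IsPrecomplete (maximalIdeal R) R := isPrecomplete_of_pow_le hk hle
    exact { (inferInstance : IsHausdorff (maximalIdeal R) R), h3 with }
  residue := hasResidueField_of_ringHom h

/-- The augmentation `ℤ₂[H] → 𝔽₂`. -/
def augmentation (H : Type*) [Monoid H] : MonoidAlgebra ℤ_[2] H →+* ZMod 2 :=
  (PadicInt.toZMod (p := 2)).comp
    (MonoidAlgebra.lift ℤ_[2] ℤ_[2] H 1 : MonoidAlgebra ℤ_[2] H →+* ℤ_[2])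

/-- The group algebra over `ℤ₂` of a finite abelian `2`-group is local. -/
theorem isLocalRing_monoidAlgebra {H : Type*} [CommGroup H] [Finite H] (hH : IsPGroup 2 H) :
    IsLocalRing (MonoidAlgebra ℤ_[2] H) := by
  have hker : (RingHom.ker (augmentation H)).IsMaximal :=
    RingHom.ker_isMaximal_of_surjective _ (ZMod.ringHom_surjective _)
  refine IsLocalRing.of_unique_max_ideal ⟨_, hker, fun M hM => ?_⟩
  refine (hker.eq_of_le hM.ne_top fun x hx => ?_).symm
  have hint : Module.Finite ℤ_[2] (MonoidAlgebra ℤ_[2] H) := inferInstance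
  have hscalar : ∀ a ∈ maximalIdeal ℤ_[2], algebraMap ℤ_[2] (MonoidAlgebra ℤ_[2] H) a ∈ M := by
    have := IsLocalRing.eq_maximalIdeal
      (Ideal.isMaximal_comap_of_isIntegral_of_isMaximal (R := ℤ_[2]) M)
    intro a ha
    rwa [← this] at ha
  have h2 : (2 : MonoidAlgebra ℤ_[2] H ⧸ M) = 0 := by
    have := hscalar 2 (by
      rw [mem_maximalIdeal_iff_of_ringHom_zmod_two PadicInt.toZMod, map_ofNat]; rfl)
    rwa [map_ofNat, ← Ideal.Quotient.eq_zero_iff_mem, map_ofNat] at this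
  have hchar : CharP (MonoidAlgebra ℤ_[2] H ⧸ M) 2 :=
    CharTwo.of_one_ne_zero_of_two_eq_zero one_ne_zero h2
  -- In the residue field at `M`, of characteristic 2, `(g - 1)^(2^n) = g^(2^n) - 1 = 0`; so `M`
  -- contains the augmentation ideal.
  have hg : ∀ g : H, (MonoidAlgebra.single g 1 - 1 : MonoidAlgebra ℤ_[2] H) ∈ M := by
    intro g
    obtain ⟨n, hn⟩ := hH g
    rw [← Ideal.Quotient.eq_zero_iff_mem, ← pow_eq_zero_iff (pow_ne_zero n two_ne_zero), map_sub,
      sub_pow_char_pow, ← map_pow, ← map_pow, MonoidAlgebra.single_pow, hn, one_pow, one_pow,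
      ← MonoidAlgebra.one_def, sub_self]
  have hx' : ∀ x : MonoidAlgebra ℤ_[2] H,
      x - algebraMap _ _ (MonoidAlgebra.lift ℤ_[2] ℤ_[2] H 1 x) ∈ M := by
    intro x
    induction x using MonoidAlgebra.induction_linear with
    | zero => simp
    | add x y hx hy =>
      rw [map_add, map_add, add_sub_add_comm]
      exact add_mem hx hy
    | single g a =>
      have : (MonoidAlgebra.single g a : MonoidAlgebra ℤ_[2] H) -
          algebraMap _ _ (MonoidAlgebra.lift ℤ_[2] ℤ_[2] H 1 (MonoidAlgebra.single g a)) =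
          algebraMap _ _ a * (MonoidAlgebra.single g 1 - 1) := by
        rw [mul_sub, ← Algebra.smul_def]
        simp
      rw [this]
      exact M.mul_mem_left _ (hg g)
  have := add_mem (hx' x)
    (hscalar _ ((mem_maximalIdeal_iff_of_ringHom_zmod_two PadicInt.toZMod _).2 hx))
  simpa using this

/-- Inverses are unique, so the swap fixes the inverse of a symmetric element. Thus the inclusion is
a local homomorphism and locality descends to the symmetric tensors. -/
theorem isUnit_symTensors_of_coe {k : Type*} [CommRing k] {G : Type*} [CommGroup G]
    {u : symTensors k G} (hu : IsUnit (u : MonoidAlgebra k (G × G))) : IsUnit u := by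
  obtain ⟨v, hv⟩ := hu.exists_right_inv
  have hmem : v ∈ symTensors k G := by
    change MonoidAlgebra.domCongr k k (MulEquiv.prodComm : G × G ≃* G × G) v = v
    have hu' : MonoidAlgebra.domCongr k k (MulEquiv.prodComm : G × G ≃* G × G)
        (u : MonoidAlgebra k (G × G)) = u := u.2
    have h := congr_arg (MonoidAlgebra.domCongr k k (MulEquiv.prodComm : G × G ≃* G × G)) hv
    rw [map_mul, map_one, hu'] at h
    exact hu.mul_left_cancel (h.trans hv.symm)
  exact IsUnit.of_mul_eq_one ⟨v, hmem⟩ (Subtype.ext hv)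

theorem isPGroup_prod {p : ℕ} {G H : Type*} [Group G] [Group H] (hG : IsPGroup p G)
    (hH : IsPGroup p H) : IsPGroup p (G × H) := by
  rintro ⟨g, h⟩
  obtain ⟨m, hm⟩ := hG g
  obtain ⟨n, hn⟩ := hH h
  refine ⟨m + n, Prod.ext ?_ ?_⟩
  · rw [Prod.pow_fst, pow_add, pow_mul, hm, one_pow, Prod.fst_one]
  · rw [Prod.pow_snd, pow_add, mul_comm, pow_mul, hn, one_pow, Prod.snd_one]

theorem isLocalRing_symTensors {G : Type*} [CommGroup G] [Finite G] (hG : IsPGroup 2 G) :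
    IsLocalRing (symTensors ℤ_[2] G) := by
  have := isLocalRing_monoidAlgebra (H := G × G) (isPGroup_prod hG hG)
  have : IsLocalHom (symTensors ℤ_[2] G).val.toRingHom := ⟨fun _ => isUnit_symTensors_of_coe⟩
  exact RingHom.domain_isLocalRing (symTensors ℤ_[2] G).val.toRingHom

end LocalRings

/-! ### The universal pseudodeformation ring. -/

section Pseudodeformation

variable {G : Type u} [CommGroup G] [Finite G]

theorem isProCoeffRing_symTensors [IsLocalRing (symTensors ℤ_[2] G)] :
    IsProCoeffRing 2 (symTensors ℤ_[2] G) :=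
  have : Module.Finite ℤ_[2] (symTensors ℤ_[2] G) :=
    Module.Finite.of_basis (symTensorsBasis ℤ_[2] G)
  isProCoeffRing_of_finite ((augmentation (G × G)).comp (symTensors ℤ_[2] G).val.toRingHom)

/-- The reduction and the trivial determinant are both classified by maps from a local ring to `𝔽₂`,
and there is only one such map. -/
theorem Determinant.isResiduallyTrivial_of_hasResidueField [IsLocalRing (symTensors ℤ_[2] G)]
    {A : Type u} [CommRing A] [IsLocalRing A] [Algebra ℤ_[2] A] (hA : HasResidueField 2 A)
    (D : Determinant A G 2) : D.IsResiduallyTrivial := by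
  obtain ⟨θ, hθ⟩ := D.exists_algHom (k := ℤ_[2])
  obtain ⟨η, hη⟩ := exists_classifiesRep (k := ℤ_[2]) (1 : G →* GL (Fin 2) (ResidueField A))
  obtain ⟨e⟩ := hA
  refine ClassifiesRep.baseChangesToRep hθ hη (fun u => e.injective ?_) rfl
  exact DFunLike.congr_fun (ringHom_zmod_two_ext
    (((e : ResidueField A →+* ZMod 2).comp (residue A)).comp (θ : symTensors ℤ_[2] G →+* A))
    ((e : ResidueField A →+* ZMod 2).comp (η : symTensors ℤ_[2] G →+* ResidueField A))) u

theorem isUniversalPseudodeformation_symTensors [IsLocalRing (symTensors ℤ_[2] G)] :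
    IsUniversalPseudodeformation 2 (determinantOf (AlgHom.id ℤ_[2] (symTensors ℤ_[2] G))) where
  isProCoeffRing := isProCoeffRing_symTensors
  residuallyTrivial :=
    Determinant.isResiduallyTrivial_of_hasResidueField isProCoeffRing_symTensors.residue _
  existsUnique A _ _ _ _ E _ := by
    obtain ⟨η, hη⟩ := E.exists_algHom (k := ℤ_[2])
    refine ⟨η, ?_, fun f hf => ?_⟩
    · exact ((determinantOf_isClassifiedBy _).isBaseChange_iff hη _).2 (AlgHom.comp_id η)
    · exact ((determinantOf_isClassifiedBy _).isBaseChange_iff hη f).1 hf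

/-- Composition with `θ` is a bijection on maps to test rings, so any universal pair is identified
with the symmetric tensors. -/
theorem IsUniversalPseudodeformation.bijective [IsLocalRing (symTensors ℤ_[2] G)]
    {R : Type u} [CommRing R] [IsLocalRing R] [Algebra ℤ_[2] R] {D : Determinant R G 2}
    (hD : IsUniversalPseudodeformation 2 D) {θ : symTensors ℤ_[2] G →ₐ[ℤ_[2]] R}
    (hθ : D.IsClassifiedBy θ) : Function.Bijective θ := by
  refine bijective_of_existsUnique isProCoeffRing_symTensors hD.isProCoeffRing θ
    fun A _ _ _ hA η => ?_
  have := hD.existsUnique A hA (determinantOf η)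
    (Determinant.isResiduallyTrivial_of_hasResidueField hA.residue _)
  simpa only [hθ.isBaseChange_iff (determinantOf_isClassifiedBy η)] using this

end Pseudodeformation

/-! ### Ideals of, and maps out of, power series rings. -/

section PowerSeries

theorem mem_span_range_X_of_constantCoeff_eq_zero {σ k : Type*} [CommRing k] [Finite σ] [Nonempty σ]
    {t : MvPowerSeries σ k} (ht : MvPowerSeries.constantCoeff t = 0) :
    t ∈ Ideal.span (Set.range (MvPowerSeries.X : σ → MvPowerSeries σ k)) := by
  classical
  have := Fintype.ofFinite σ
  -- For each nonzero exponent, `v` selects one variable that occurs in it; grouping the terms of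
  -- `t` by this choice writes `t` as a combination of the variables.
  have hv : ∀ m : σ →₀ ℕ, ∃ s, m ≠ 0 → m s ≠ 0 := by
    intro m
    by_cases hm : m = 0
    · exact ⟨Classical.arbitrary σ, fun h => absurd hm h⟩
    · obtain ⟨s, hs⟩ := Finsupp.ne_iff.1 hm
      exact ⟨s, fun _ => hs⟩
  choose v hv using hv
  let f : σ → MvPowerSeries σ k := fun s m =>
    if v (m + Finsupp.single s 1) = s then MvPowerSeries.coeff (m + Finsupp.single s 1) t else 0
  have : t = ∑ s, MvPowerSeries.X s * f s := by
    ext n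
    have hterm : ∀ s, MvPowerSeries.coeff n (MvPowerSeries.X s * f s) =
        if n s ≠ 0 ∧ v n = s then MvPowerSeries.coeff n t else 0 := by
      intro s
      rw [MvPowerSeries.X, MvPowerSeries.coeff_monomial_mul, one_mul, ite_and]
      refine if_ctx_congr (Finsupp.single_le_iff.trans Nat.one_le_iff_ne_zero) (fun h => ?_)
        fun _ => rfl
      have hns : n - Finsupp.single s 1 + Finsupp.single s 1 = n :=
        tsub_add_cancel_of_le (Finsupp.single_le_iff.2 (Nat.one_le_iff_ne_zero.2 h))
      change (if v (n - Finsupp.single s 1 + Finsupp.single s 1) = s then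
        MvPowerSeries.coeff (n - Finsupp.single s 1 + Finsupp.single s 1) t else 0) = _
      rw [hns]
    rw [map_sum, Finset.sum_congr rfl fun s _ => hterm s]
    by_cases hn : n = 0
    · subst hn
      simpa using ht
    · rw [Finset.sum_eq_single (v n) (fun s _ hs => if_neg fun h => hs h.2.symm) (by simp),
        if_pos ⟨hv n hn, rfl⟩]
  rw [this]
  exact sum_mem fun s _ => Ideal.mul_mem_right _ _ (Ideal.subset_span ⟨s, rfl⟩)

/-- With discrete topologies, nilpotent elements are topologically nilpotent, so continuous
evaluation of power series applies. -/
theorem exists_algHom_mvPowerSeries {σ k A : Type*} [Finite σ] [CommRing k] [CommRing A]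
    [Algebra k A] (a : σ → A) (ha : ∀ s, IsNilpotent (a s)) :
    ∃ f : MvPowerSeries σ k →ₐ[k] A, ∀ s, f (MvPowerSeries.X s) = a s := by
  let : UniformSpace k := ⊥
  let : UniformSpace A := ⊥
  have : DiscreteTopology k := ⟨rfl⟩
  have : DiscreteTopology A := ⟨rfl⟩
  have : DiscreteUniformity k := ⟨rfl⟩
  have : DiscreteUniformity A := ⟨rfl⟩
  have : ContinuousSMul k A := ⟨continuous_of_discreteTopology⟩
  have he : MvPowerSeries.HasEval a :=
    { hpow := fun s => (ha s).isTopologicallyNilpotent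
      tendsto_zero := by simp }
  exact ⟨MvPowerSeries.aeval he, fun s => by
    rw [← MvPolynomial.coe_X, MvPowerSeries.aeval_coe, MvPolynomial.aeval_X]⟩

end PowerSeries

/-! ### The universal lifting ring. -/

section LiftingRing

variable (G : Type u) [Group G]

/-- Power series over `ℤ₂` in a variable for every entry of a `2 × 2` matrix for every element
of `G`, and one further variable, which is to specialize to `2`. -/
abbrev LiftingPowerSeries : Type u := MvPowerSeries (Option (G × Fin 2 × Fin 2)) ℤ_[2]

variable {G} in
/-- The generic matrix at `g`. -/
def genericMatrix (g : G) : Matrix (Fin 2) (Fin 2) (LiftingPowerSeries G) :=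
  1 + Matrix.of fun i j => MvPowerSeries.X (some (g, i, j))

/-- The relations that make the generic matrices a representation. -/
inductive LiftingRelation : LiftingPowerSeries G → Prop
  | two : LiftingRelation (MvPowerSeries.X none - 2)
  | one (i j : Fin 2) : LiftingRelation ((genericMatrix (1 : G) - 1) i j)
  | mul (g h : G) (i j : Fin 2) :
      LiftingRelation ((genericMatrix (g * h) - genericMatrix g * genericMatrix h) i j)

/-- The ideal generated by the relations. -/
def liftingIdeal : Ideal (LiftingPowerSeries G) := Ideal.span (Set.ofPred (LiftingRelation G))

/-- The universal lifting ring of the trivial two-dimensional representation. -/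
abbrev LiftingRing : Type u := LiftingPowerSeries G ⧸ liftingIdeal G

variable {G}

theorem liftingIdeal_le_ker {A : Type*} [CommRing A] (f : LiftingPowerSeries G →+* A)
    (h2 : f (MvPowerSeries.X none) = 2) (σ : G →* Matrix (Fin 2) (Fin 2) A)
    (hσ : ∀ g, f.mapMatrix (genericMatrix g) = σ g) : liftingIdeal G ≤ RingHom.ker f := by
  refine Ideal.span_le.2 ?_
  rintro _ (_ | ⟨i, j⟩ | ⟨g, h, i, j⟩)
  · change f (MvPowerSeries.X none - 2) = 0
    rw [map_sub, h2, map_ofNat, sub_self]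
  · have : f.mapMatrix (genericMatrix (1 : G) - 1) = 0 := by
      rw [map_sub, hσ, map_one, map_one, sub_self]
    exact congr_fun (congr_fun this i) j
  · have : f.mapMatrix (genericMatrix (g * h) - genericMatrix g * genericMatrix h) = 0 := by
      rw [map_sub, map_mul, hσ, hσ, hσ, map_mul, sub_self]
    exact congr_fun (congr_fun this i) j

variable (G) in
/-- The reduction of power series to the residue field. -/
def liftingResidue : LiftingPowerSeries G →+* ZMod 2 :=
  (PadicInt.toZMod (p := 2)).comp MvPowerSeries.constantCoeff

omit [Group G] in
theorem liftingResidue_X (s : Option (G × Fin 2 × Fin 2)) :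
    liftingResidue G (MvPowerSeries.X s) = 0 := by
  simp [liftingResidue]

omit [Group G] in
theorem mapMatrix_genericMatrix {A : Type*} [CommRing A] (f : LiftingPowerSeries G →+* A) (g : G) :
    f.mapMatrix (genericMatrix g) =
      1 + Matrix.of fun i j => f (MvPowerSeries.X (some (g, i, j))) := by
  rw [genericMatrix, map_add, map_one]
  rfl

variable (G) in
/-- The reduction of the lifting ring to its residue field. -/
def liftingRingResidue : LiftingRing G →+* ZMod 2 :=
  Ideal.Quotient.lift _ (liftingResidue G) (liftingIdeal_le_ker _
    ((liftingResidue_X _).trans (by decide)) 1 fun g => by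
      rw [mapMatrix_genericMatrix]
      ext i j
      simp [liftingResidue_X])

instance : IsLocalRing (LiftingRing G) :=
  have := (liftingRingResidue G).domain_nontrivial
  IsLocalRing.of_surjective' (Ideal.Quotient.mk _) Ideal.Quotient.mk_surjective

theorem mk_X_none : Ideal.Quotient.mk (liftingIdeal G) (MvPowerSeries.X none) = 2 := by
  have : MvPowerSeries.X none - 2 ∈ liftingIdeal G := Ideal.subset_span .two
  rw [← Ideal.Quotient.eq_zero_iff_mem, map_sub, sub_eq_zero] at this
  rw [this, map_ofNat]

/-- This is what the extra variable is for: as its image is 2, the images of the variables generate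
the whole maximal ideal, and completeness comes from the ideal of variables upstairs. -/
theorem span_mk_X_eq_maximalIdeal [Finite G] : Ideal.span (Set.range fun s =>
    Ideal.Quotient.mk (liftingIdeal G) (MvPowerSeries.X s)) = maximalIdeal (LiftingRing G) := by
  refine le_antisymm (Ideal.span_le.2 ?_) fun x hx => ?_
  · rintro _ ⟨s, rfl⟩
    exact (mem_maximalIdeal_iff_of_ringHom_zmod_two (liftingRingResidue G) _).2 (liftingResidue_X s)
  · obtain ⟨t, rfl⟩ := Ideal.Quotient.mk_surjective x
    have h0 : liftingResidue G t = 0 :=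
      (mem_maximalIdeal_iff_of_ringHom_zmod_two (liftingRingResidue G) _).1 hx
    have hc : MvPowerSeries.constantCoeff t ∈ maximalIdeal ℤ_[2] :=
      (mem_maximalIdeal_iff_of_ringHom_zmod_two PadicInt.toZMod _).2 h0
    rw [PadicInt.maximalIdeal_eq_span_p, Ideal.mem_span_singleton'] at hc
    obtain ⟨b, hb⟩ := hc
    have h1 : t - MvPowerSeries.C (MvPowerSeries.constantCoeff t) ∈
        Ideal.span (Set.range (MvPowerSeries.X : _ → LiftingPowerSeries G)) :=
      mem_span_range_X_of_constantCoeff_eq_zero (by simp)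
    have h2 := Ideal.mem_map_of_mem (Ideal.Quotient.mk (liftingIdeal G)) h1
    rw [Ideal.map_span, ← Set.range_comp, map_sub] at h2
    have h3 : Ideal.Quotient.mk (liftingIdeal G)
        (MvPowerSeries.C (MvPowerSeries.constantCoeff t)) ∈ Ideal.span (Set.range fun s =>
          Ideal.Quotient.mk (liftingIdeal G) (MvPowerSeries.X s)) := by
      rw [← hb, map_mul, map_mul, Nat.cast_ofNat, map_ofNat, map_ofNat, ← mk_X_none]
      exact Ideal.mul_mem_left _ _ (Ideal.subset_span ⟨none, rfl⟩)
    have h4 := add_mem h2 h3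
    rwa [sub_add_cancel] at h4

theorem isProCoeffRing_liftingRing [Finite G] : IsProCoeffRing 2 (LiftingRing G) where
  noetherian := inferInstance
  complete := by
    refine isAdicComplete_of_surjective
      (Ideal.span (Set.range (MvPowerSeries.X : _ → LiftingPowerSeries G)))
      (Ideal.Quotient.mk (liftingIdeal G)) Ideal.Quotient.mk_surjective ?_
    rw [Ideal.map_span, ← Set.range_comp, ← span_mk_X_eq_maximalIdeal]
    rfl
  residue := hasResidueField_of_ringHom (liftingRingResidue G)

variable (G) in
/-- The universal lifting. -/
def universalLifting : G →* GL (Fin 2) (LiftingRing G) :=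
  MonoidHom.toHomUnits
    { toFun := fun g => (Ideal.Quotient.mk (liftingIdeal G)).mapMatrix (genericMatrix g)
      map_one' := by
        rw [← sub_eq_zero, ← map_one (Ideal.Quotient.mk (liftingIdeal G)).mapMatrix, ← map_sub]
        ext i j
        exact Ideal.Quotient.eq_zero_iff_mem.2 (Ideal.subset_span (.one i j))
      map_mul' := fun g h => by
        rw [← sub_eq_zero, ← map_mul, ← map_sub]
        ext i j
        exact Ideal.Quotient.eq_zero_iff_mem.2 (Ideal.subset_span (.mul g h i j)) }

theorem coe_universalLifting (g : G) : (universalLifting G g : Matrix (Fin 2) (Fin 2) _) =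
    1 + Matrix.of fun i j =>
      Ideal.Quotient.mk (liftingIdeal G) (MvPowerSeries.X (some (g, i, j))) :=
  mapMatrix_genericMatrix _ g

theorem isUniversalLifting_universalLifting [Finite G] :
    IsUniversalLifting 2 (universalLifting G) where
  isProCoeffRing := isProCoeffRing_liftingRing
  isLifting := by
    refine MonoidHom.ext fun g => Units.ext ?_
    change (residue (LiftingRing G)).mapMatrix (universalLifting G g : Matrix (Fin 2) (Fin 2) _) = 1
    rw [coe_universalLifting, map_add, map_one, add_eq_left]
    ext i j
    change residue _ _ = 0
    rw [residue_eq_zero_iff, ← span_mk_X_eq_maximalIdeal]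
    exact Ideal.subset_span ⟨_, rfl⟩
  existsUnique A _ _ _ hA σ hσ := by
    have hA' := hA.artinian
    obtain ⟨N, hN⟩ := (isArtinianRing_iff_isNilpotent_maximalIdeal A).1 hA.artinian
    have hnil : ∀ x ∈ maximalIdeal A, IsNilpotent x := fun x hx =>
      ⟨N, by simpa [hN] using Ideal.pow_mem_pow hx N⟩
    obtain ⟨π⟩ := hA.residue.nonempty_ringHom
    -- The extra variable goes to 2 and the others to the entries of `σ(g) - 1`; all lie in the
    -- nilpotent maximal ideal.
    obtain ⟨f, hf⟩ := exists_algHom_mvPowerSeries (k := ℤ_[2])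
      (fun s : Option (G × Fin 2 × Fin 2) => s.elim (2 : A) fun p =>
        ((σ p.1 : Matrix (Fin 2) (Fin 2) A) - 1) p.2.1 p.2.2) (by
        rintro (_ | ⟨g, i, j⟩)
        · refine hnil _ ((mem_maximalIdeal_iff_of_ringHom_zmod_two π _).2 ?_)
          change π 2 = 0
          rw [map_ofNat]
          decide
        · refine hnil _ ((residue_eq_zero_iff _).1 ?_)
          have h : (residue A).mapMatrix ((σ g : Matrix (Fin 2) (Fin 2) A) - 1) = 0 := by
            have : (residue A).mapMatrix (σ g : Matrix (Fin 2) (Fin 2) A) = 1 :=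
              congr_arg Units.val (DFunLike.congr_fun hσ g)
            rw [map_sub, this, map_one, sub_self]
          exact congr_fun (congr_fun h i) j)
    have hfσ : ∀ g, (f : LiftingPowerSeries G →+* A).mapMatrix (genericMatrix g) = σ g := by
      intro g
      rw [mapMatrix_genericMatrix]
      ext i j
      have := hf (some (g, i, j))
      simp only [Option.elim_some] at this
      simp [this]
    refine ⟨Ideal.Quotient.liftₐ _ f (liftingIdeal_le_ker (f : LiftingPowerSeries G →+* A)
      (hf none) ((Units.coeHom _).comp σ) hfσ), ?_, fun f' hf' => ?_⟩
    · refine MonoidHom.ext fun g => Units.ext ?_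
      rw [← hfσ]
      rfl
    · refine algHom_ext_of_span_eq_maximalIdeal isProCoeffRing_liftingRing.residue hA
        span_mk_X_eq_maximalIdeal ?_
      rintro _ ⟨_ | ⟨g, i, j⟩, rfl⟩
      · simp only [mk_X_none, map_ofNat]
      · have h : (f' : LiftingRing G →+* A).mapMatrix
            (universalLifting G g : Matrix (Fin 2) (Fin 2) _) = σ g :=
          congr_arg Units.val (DFunLike.congr_fun hf' g)
        rw [coe_universalLifting, map_add, map_one, ← eq_sub_iff_add_eq'] at h
        have h' := congr_fun (congr_fun h i) j
        exact h'.trans (hf (some (g, i, j))).symm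

end LiftingRing

/-! ### The pseudodeformation ring inside the lifting ring. -/

section Comparison

variable {G : Type u} [CommGroup G] [Finite G]

variable (G) in
/-- The sum of the two tautological characters of `G` with values in `ℤ₂[G × G]`. -/
def sumOfCharacters : G →* GL (Fin 2) (MonoidAlgebra ℤ_[2] (G × G)) :=
  MonoidHom.toHomUnits
    { toFun := fun g => Matrix.diagonal
        ![tensorInl ℤ_[2] G (MonoidAlgebra.single g 1),
          tensorInr ℤ_[2] G (MonoidAlgebra.single g 1)]
      map_one' := by
        rw [← MonoidAlgebra.one_def, map_one, map_one, ← Matrix.diagonal_one]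
        congr 1
        ext i
        fin_cases i <;> rfl
      map_mul' := fun g h => by
        rw [Matrix.diagonal_mul_diagonal, ← one_mul (1 : ℤ_[2]), ← MonoidAlgebra.single_mul_single,
          map_mul, map_mul, one_mul]
        congr 1
        ext i
        fin_cases i <;> rfl }

omit [Finite G] in
theorem coe_sumOfCharacters (g : G) : (sumOfCharacters G g : Matrix (Fin 2) (Fin 2) _) =
    Matrix.diagonal ![tensorInl ℤ_[2] G (MonoidAlgebra.single g 1),
      tensorInr ℤ_[2] G (MonoidAlgebra.single g 1)] := rfl

omit [Finite G] in
-- The linear extension is diagonal with entries `x ⊗ 1` and `1 ⊗ x`, whose product is the square of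
-- `x`.
theorem classifiesRep_sumOfCharacters :
    ClassifiesRep (symTensors ℤ_[2] G).val (sumOfCharacters G) := by
  have h : ∀ x : MonoidAlgebra ℤ_[2] G, linExt (RingHom.id (MonoidAlgebra ℤ_[2] (G × G)))
      (sumOfCharacters G) (MonoidAlgebra.mapRingHom G (algebraMap ℤ_[2] _) x) =
        Matrix.diagonal ![tensorInl ℤ_[2] G x, tensorInr ℤ_[2] G x] := by
    intro x
    induction x using MonoidAlgebra.induction_linear with
    | zero => ext i j; fin_cases i <;> fin_cases j <;> simp
    | add x y hx hy =>
      rw [map_add, map_add, hx, hy, Matrix.diagonal_add]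
      congr 1
      ext1 i
      fin_cases i <;> simp
    | single g a =>
      rw [MonoidAlgebra.mapRingHom_single, linExt, MonoidAlgebra.lift_single]
      change algebraMap ℤ_[2] (MonoidAlgebra ℤ_[2] (G × G)) a •
        (sumOfCharacters G g : Matrix (Fin 2) (Fin 2) (MonoidAlgebra ℤ_[2] (G × G))) = _
      rw [coe_sumOfCharacters, algebraMap_smul, ← Matrix.diagonal_smul]
      congr 1
      ext1 i
      fin_cases i <;> simp
  intro x
  rw [h, Matrix.det_diagonal]
  simp [coe_symSquare]

omit [Finite G] in
theorem isLifting_map_sumOfCharacters {A : Type u} [CommRing A] [IsLocalRing A]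
    (hA : HasResidueField 2 A) (f : MonoidAlgebra ℤ_[2] (G × G) →+* A) :
    IsLifting ((Matrix.GeneralLinearGroup.map f).comp (sumOfCharacters G)) := by
  obtain ⟨e⟩ := hA
  have hone : ∀ x : G × G, residue A (f (MonoidAlgebra.single x 1)) = 1 := by
    intro x
    have hu : IsUnit (MonoidAlgebra.single x 1 : MonoidAlgebra ℤ_[2] (G × G)) :=
      (Group.isUnit x).map (MonoidAlgebra.of ℤ_[2] (G × G))
    apply e.injective
    rw [map_one]
    exact zmod_two_eq_one_of_ne_zero (((hu.map f).map (residue A)).map e).ne_zero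
  refine MonoidHom.ext fun g => Units.ext ?_
  change (residue A).mapMatrix (f.mapMatrix (sumOfCharacters G g : Matrix (Fin 2) (Fin 2) _)) = 1
  rw [coe_sumOfCharacters, tensorInl_single, tensorInr_single]
  ext i j
  fin_cases i <;> fin_cases j <;> simp [hone]

/-- Modulo each power of the maximal ideal of `ℤ₂[G × G]`, the sum of characters is a specialization
of `ρ`, so the inclusion of the symmetric tensors factors through `θ` there. An element killed by
`θ` lies in all powers, hence vanishes. -/
theorem ClassifiesRep.injective (hG : IsPGroup 2 G) {R : Type u} [CommRing R] [IsLocalRing R]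
    [Algebra ℤ_[2] R] {ρ : G →* GL (Fin 2) R} (hρ : IsUniversalLifting 2 ρ)
    {θ : symTensors ℤ_[2] G →ₐ[ℤ_[2]] R} (hθ : ClassifiesRep θ ρ) : Function.Injective θ := by
  have := isLocalRing_monoidAlgebra (isPGroup_prod hG hG)
  have hΛ : IsProCoeffRing 2 (MonoidAlgebra ℤ_[2] (G × G)) :=
    isProCoeffRing_of_finite (augmentation (G × G))
  have := hΛ.noetherian
  rw [injective_iff_map_eq_zero]
  intro u hu
  apply Subtype.ext
  change (u : MonoidAlgebra ℤ_[2] (G × G)) = 0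
  rw [IsHausdorff.eq_iff_smodEq (I := maximalIdeal (MonoidAlgebra ℤ_[2] (G × G)))]
  intro n
  refine SModEq.mono (Submodule.pow_smul_top_le _ _ n.le_succ) ?_
  have hA := isCoeffRing_quotient_pow_succ hΛ.residue n
  obtain ⟨f, hf, -⟩ := hρ.existsUnique _ hA _ (isLifting_map_sumOfCharacters hA.residue
    (Ideal.Quotient.mkₐ ℤ_[2] (maximalIdeal (MonoidAlgebra ℤ_[2] (G × G)) ^ (n + 1)) :
      MonoidAlgebra ℤ_[2] (G × G) →+* _))
  have h1 := hθ.comp f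
  rw [hf] at h1
  have h2 := classifiesRep_sumOfCharacters.comp
    (Ideal.Quotient.mkₐ ℤ_[2] (maximalIdeal (MonoidAlgebra ℤ_[2] (G × G)) ^ (n + 1)))
  have h3 : f.comp θ = _ := symTensors_algHom_ext fun x => (h1 x).trans (h2 x).symm
  have h4 := DFunLike.congr_fun h3 u
  rw [AlgHom.comp_apply, hu, map_zero] at h4
  rw [SModEq.zero, smul_eq_mul, Ideal.mul_top]
  exact Ideal.Quotient.eq_zero_iff_mem.1 h4.symm

theorem ClassifiesRep.range_eq_coeffSubring {R : Type u} [CommRing R] [Algebra ℤ_[2] R]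
    {ρ : G →* GL (Fin 2) R} {θ : symTensors ℤ_[2] G →ₐ[ℤ_[2]] R} (hθ : ClassifiesRep θ ρ) :
    θ.range = coeffSubring 2 ρ := by
  rcases subsingleton_or_nontrivial R with h | h
  · exact Subsingleton.elim _ _
  have hdet : ∀ g, (ρ g : Matrix (Fin 2) (Fin 2) R).det ∈ coeffSubring 2 ρ := fun g =>
    Algebra.subset_adjoin ⟨g, 0, by simp [Matrix.charpoly_fin_two]⟩
  have htr : ∀ g, (ρ g : Matrix (Fin 2) (Fin 2) R).trace ∈ coeffSubring 2 ρ := by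
    intro g
    rw [← neg_mem_iff]
    exact Algebra.subset_adjoin ⟨g, 1, by simp [Matrix.charpoly_fin_two, Polynomial.coeff_X_pow]⟩
  -- Write `g = (gh⁻¹)h` and apply the identity for `det (MN + N)`. Taking `h = 1` later recovers
  -- the traces.
  have hpolar : ∀ g h, θ (QuadraticMap.polar (symSquare ℤ_[2] G) (MonoidAlgebra.single g 1)
      (MonoidAlgebra.single h 1)) = (ρ (g * h⁻¹) : Matrix (Fin 2) (Fin 2) R).trace *
        (ρ h : Matrix (Fin 2) (Fin 2) R).det := by
    intro g h
    have hg : (ρ g : Matrix (Fin 2) (Fin 2) R) =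
        (ρ (g * h⁻¹) : Matrix (Fin 2) (Fin 2) R) * (ρ h : Matrix (Fin 2) (Fin 2) R) := by
      rw [← Units.val_mul, ← map_mul, inv_mul_cancel_right]
    rw [← det_add_det_fin_two, ← hg, QuadraticMap.polar, map_sub, map_sub,
      hθ.apply_single_add_single, hθ.apply_single, hθ.apply_single]
  apply le_antisymm
  · rintro _ ⟨u, rfl⟩
    have hu := (symTensorsBasis ℤ_[2] G).mem_span u
    change θ u ∈ _
    induction hu using Submodule.span_induction with
    | mem x hx =>
      obtain ⟨z, rfl⟩ := hx
      induction z with | _ g h =>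
      by_cases hgh : g = h
      · subst hgh
        rw [symTensorsBasis_diag, hθ.apply_single]
        exact hdet g
      · rw [symTensorsBasis_of_ne hgh, hpolar]
        exact mul_mem (htr _) (hdet _)
    | zero => simp
    | add x y _ _ hx hy => rw [map_add]; exact add_mem hx hy
    | smul c x _ hx => rw [map_smul]; exact Subalgebra.smul_mem _ hx c
  · refine Algebra.adjoin_le ?_
    rintro _ ⟨g, i, rfl⟩
    have hdet' : (ρ g : Matrix (Fin 2) (Fin 2) R).det ∈ θ.range := ⟨_, hθ.apply_single g⟩
    have htr' : (ρ g : Matrix (Fin 2) (Fin 2) R).trace ∈ θ.range :=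
      ⟨_, (hpolar g 1).trans (by simp)⟩
    rw [Matrix.charpoly_fin_two, Polynomial.coeff_add, Polynomial.coeff_sub,
      Polynomial.coeff_X_pow, Polynomial.coeff_C_mul, Polynomial.coeff_X, Polynomial.coeff_C]
    refine add_mem (sub_mem ?_ (mul_mem htr' ?_)) ?_
    · split_ifs
      exacts [one_mem _, zero_mem _]
    · split_ifs
      exacts [one_mem _, zero_mem _]
    · split_ifs
      exacts [hdet', zero_mem _]

end Comparison

theorem finrank_symTensors {G : Type*} [CommGroup G] [Finite G] :
    ∃ r, 0 < r ∧ 2 * r = Nat.card G * (Nat.card G + 1) ∧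
      Nonempty (symTensors ℤ_[2] G ≃ₗ[ℤ_[2]] (Fin r → ℤ_[2])) := by
  have := Fintype.ofFinite G
  have : Nonempty (Sym2 G) := ⟨s(1, 1)⟩
  refine ⟨Nat.card (Sym2 G), Nat.card_pos, ?_,
    ⟨(symTensorsEquiv ℤ_[2] G).trans (LinearEquiv.funCongrLeft _ _ (Finite.equivFin _).symm)⟩⟩
  classical
  rw [Nat.card_eq_fintype_card, Nat.card_eq_fintype_card, Sym2.card, Nat.choose_two_right,
    Nat.mul_div_cancel' (Nat.even_mul_pred_self _).two_dvd, Nat.add_sub_cancel, mul_comm]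

end

end PseudoDef

theorem mainTheorem3 {G : Type u} [CommGroup G] [Finite G] (hG : IsPGroup 2 G) :
    -- the universal pseudodeformation ring exists
    (∃ (R : Type u) (_ : CommRing R) (_ : IsLocalRing R) (_ : Algebra ℤ_[2] R)
      (D : PseudoDef.Determinant R G 2), PseudoDef.IsUniversalPseudodeformation 2 D) ∧
    -- the universal lifting ring exists
    (∃ (R : Type u) (_ : CommRing R) (_ : IsLocalRing R) (_ : Algebra ℤ_[2] R)
      (ρ : G →* GL (Fin 2) R), PseudoDef.IsUniversalLifting 2 ρ) ∧
    -- the comparison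
    ∃ r : ℕ, 0 < r ∧ 2 * r = Nat.card G * (Nat.card G + 1) ∧
      ∀ (Rps : Type u) [CommRing Rps] [IsLocalRing Rps] [Algebra ℤ_[2] Rps]
        (D : PseudoDef.Determinant Rps G 2)
        (Rsq : Type u) [CommRing Rsq] [IsLocalRing Rsq] [Algebra ℤ_[2] Rsq]
        (ρ : G →* GL (Fin 2) Rsq),
        PseudoDef.IsUniversalPseudodeformation 2 D → PseudoDef.IsUniversalLifting 2 ρ →
          (∃ e : Rps ≃ₐ[ℤ_[2]] PseudoDef.coeffSubring 2 ρ,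
            D.BaseChangesToRep
              (((PseudoDef.coeffSubring 2 ρ).val.comp e.toAlgHom : Rps →ₐ[ℤ_[2]] Rsq) :
                Rps →+* Rsq) ρ) ∧
          Nonempty (Rps ≃ₗ[ℤ_[2]] (Fin r → ℤ_[2])) ∧
          Nonempty (PseudoDef.coeffSubring 2 ρ ≃ₗ[ℤ_[2]] (Fin r → ℤ_[2])) := by
  have := PseudoDef.isLocalRing_symTensors hG
  refine ⟨⟨_, _, _, _, _, PseudoDef.isUniversalPseudodeformation_symTensors⟩,
    ⟨_, _, _, _, _, PseudoDef.isUniversalLifting_universalLifting⟩, ?_⟩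
  obtain ⟨r, hr0, hr, ⟨b⟩⟩ := PseudoDef.finrank_symTensors (G := G)
  refine ⟨r, hr0, hr, fun Rps _ _ _ D Rsq _ _ _ ρ hD hρ => ?_⟩
  obtain ⟨θ, hθ⟩ := D.exists_algHom (k := ℤ_[2])
  obtain ⟨η, hη⟩ := PseudoDef.exists_classifiesRep (k := ℤ_[2]) ρ
  -- Both rings are compared with the symmetric tensors: `θ` classifies `D` and `η` classifies `det
  -- ∘ ρ`, so `e₂ ∘ e₁⁻¹` carries one determinant to the other.
  let e₁ : PseudoDef.symTensors ℤ_[2] G ≃ₐ[ℤ_[2]] Rps := AlgEquiv.ofBijective θ (hD.bijective hθ)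
  let e₂ : PseudoDef.symTensors ℤ_[2] G ≃ₐ[ℤ_[2]] PseudoDef.coeffSubring 2 ρ :=
    (AlgEquiv.ofInjective η (hη.injective hG hρ)).trans
      (Subalgebra.equivOfEq _ _ hη.range_eq_coeffSubring)
  refine ⟨⟨e₁.symm.trans e₂, hη.baseChangesToRep hθ (fun u => ?_) (AlgHom.comp_algebraMap _)⟩,
    ⟨e₁.symm.toLinearEquiv.trans b⟩, ⟨e₂.symm.toLinearEquiv.trans b⟩⟩
  change (e₂ (e₁.symm (e₁ u)) : Rsq) = η u
  rw [AlgEquiv.symm_apply_apply]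
  rfl
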